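/- **Setting.** Let $N=2^m$, let $G_N=\left[\begin{smallmatrix}1&0\\1&1\end{smallmatrix}\right]^{\otimes m}$ over $\mathbb F_2$, and let $\mathbf g_1,\dots,\mathbf g_N$ be its rows. Fix $0<\beta'<\beta<\frac12$, a source standard deviation $\sigma_s>0$ and a target distortion $0<\Delta<\sigma_s^2$. Put $\sigma_r^2=\sigma_s^2-\Delta$ and $\tilde\sigma_\Delta^2=\sigma_r^2\Delta/\sigma_s^2$. For every $N$ let $\eta=\eta_N>0$ and $r=r_N\in\mathbb N$ satisfy $1/\eta^2=\Theta(N)$ and $2^r\eta=\sqrt N$. Let $X$ have the discrete Gaussian distribution on $\eta\mathbb Z$ with $P(X=\eta n)\propto e^{-\eta^2n^2/(2\sigma_r^2)}$, and let $Y'=X+W$ with $W\sim\mathcal N(0,\Delta)$ independent of $X$. For $\ell\ge1$ let $X_\ell\in\{0,1\}$ be the $\ell$-th binary digit of $X/\eta$, that is, $X/\eta\equiv\sum_{j\le \ell}2^{j-1}X_j \pmod{2^\ell}$ for all $\ell$. Take $N$ i.i.d. copies $(X^{[N]},Y'^{[N]})$, and let $U_\ell^{[N]}=X_\ell^{[N]}G_N$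 over $\mathbb F_2$. For a bit $B$ and an observation $S$ (with a discrete and a continuous part) let $Z(B|S)=2\int\sqrt{p(0,s)\,p(1,s)}\,ds$ be the Bhattacharyya parameter, where $p$ is the joint density of $(B,S)$. For $1\le\ell\le r$ define the information set $$\mathcal I_\ell=\left\{i\in[N]: Z\left(U_\ell^i\,\middle|\,U_\ell^{1:i-1},X_{1:\ell-1}^{[N]},Y'^{[N]}\right)<1-2^{-N^\beta}\right\}.$$ The quantization lattice $\Lambda_Q\subset\mathbb R^N$ is the Construction D lattice generated by all vectors $$\eta\left(\sum_{\ell=1}^r2^{\ell-1}\sum_{j\in\mathcal I_\ell}u_\ell^j\,\psi(\mathbf g_j)+2^r\mathbf z\right),\qquad u_\ell^j\in\{0,1\},\ \mathbf z\in\mathbb Z^N,$$ where $\psi:\mathbb F_2^N\to\{0,1\}^N\subset\mathbb Z^N$ is the natural embedding. (If $\mathcal I_1\subseteq\dots\subseteq\mathcal I_r$, these vectors are themselves the lattice.) Let $\mathcal V(\Lambda_Q)$ be the Voronoi cell of $\Lambda_Q$ around $0$, let $V(\Lambda_Q)$ be its volume, and let the second moment be $$\sigma^2(\Lambda_Q)=\frac{1}{N\,V(\Lambda_Q)}\int_{\mathcal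 V(\Lambda_Q)}\|\mathbf u\|^2\,d\mathbf u .$$ **Lemma.** There is a constant $\beta''$ with $0<\beta''<\beta'$, not depending on $\sigma_s,\Delta,\eta,r,N$, such that for all sufficiently large $N=2^m$ (depending on $\sigma_s$, $\Delta$ and the sequences $\eta_N,r_N$) $$\sigma^2(\Lambda_Q)\le\frac{N}{N+2}\left(\tilde\sigma_\Delta^2+2^{-N^{\beta''}}\right).$$ -/

import Mathlib

open Filter MeasureTheory Asymptotics

noncomputable section

namespace PolarLattice

/-! ### Polar transform -/

/-- The `2 × 2` polarization kernel `[1 0; 1 1]` over `𝔽₂`. -/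
def kernel : Matrix (Fin 2) (Fin 2) (ZMod 2) := !![1, 0; 1, 1]

/-- The matrix `G_N`, `N = 2 ^ m`: the `m`-fold Kronecker power of the kernel
(no bit reversal), with rows and columns in their usual lexicographic order. -/
def polarMatrix : (m : ℕ) → Matrix (Fin (2 ^ m)) (Fin (2 ^ m)) (ZMod 2)
  | 0 => 1
  | m + 1 =>
    Matrix.reindex (finProdFinEquiv.trans (finCongr (pow_succ' 2 m).symm))
      (finProdFinEquiv.trans (finCongr (pow_succ' 2 m).symm))
      (Matrix.kroneckerMap (· * ·) kernel (polarMatrix m))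

/-! ### The test channel `X → Y'` with discrete Gaussian input -/

/-- Density at `y` of the real Gaussian distribution with mean `c` and variance `v`. -/
def gaussDensity (c v y : ℝ) : ℝ := ProbabilityTheory.gaussianPDFReal c v.toNNReal y

/-- The probability that the discrete Gaussian distribution on `η ℤ`, centred at `0` and with
parameter `v` (the variance of the continuous Gaussian it samples), gives to the point `η n`. -/
def discreteGaussian (η v : ℝ) (n : ℤ) : ℝ :=
  gaussDensity 0 v (η * n) / ∑' k : ℤ, gaussDensity 0 v (η * k)

/-- Joint law of `N` independent copies of the pair `(X, Y')`, where `X` is discrete Gaussian on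
`η ℤ` with parameter `vr` and `Y' = X + noise` with independent Gaussian noise of variance `Δ`:
mass in `X = η x`, density in `Y' = y`. -/
def jointDensity {N : ℕ} (η vr Δ : ℝ) (x : Fin N → ℤ) (y : Fin N → ℝ) : ℝ :=
  ∏ i, discreteGaussian η vr (x i) * gaussDensity (η * x i) Δ (y i)

/-- The label of `η n` in the partition `η 2 ^ ℓ ℤ / η 2 ^ (ℓ + 1) ℤ`, i.e. the binary digit of
`n` of weight `2 ^ ℓ`. Levels are numbered from `0` here. -/
def levelBit (ℓ : ℕ) (n : ℤ) : ZMod 2 := ((n / 2 ^ ℓ : ℤ) : ZMod 2)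

/-- The vector of labels at level `ℓ`. -/
def levelBits {N : ℕ} (ℓ : ℕ) (x : Fin N → ℤ) : Fin N → ZMod 2 := fun i => levelBit ℓ (x i)

/-- The polarized vector `U_ℓ = X_ℓ G_N` at level `ℓ`. -/
def polarBits {m : ℕ} (ℓ : ℕ) (x : Fin (2 ^ m) → ℤ) : Fin (2 ^ m) → ZMod 2 :=
  Matrix.vecMul (levelBits ℓ x) (polarMatrix m)

/-! ### Bhattacharyya parameters and information sets -/

/-- The Bhattacharyya parameter `Z(B | S, Y) = 2 ∑ₛ ∫ √(p(0, s, y) p(1, s, y)) dy` of a bit `B`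
given a discrete observation `S` and a continuous observation `Y` with joint density `p`. -/
def bhattacharyya {S E : Type*} [Fintype S] [MeasureSpace E] (p : ZMod 2 → S → E → ℝ) : ℝ :=
  2 * ∑ s, ∫ y, √(p 0 s y * p 1 s y)

/-- The discrete observation attached to the bit `U_ℓ^i`: the preceding bits `U_ℓ^j`, `j < i`, and
all labels of the preceding levels. -/
abbrev Past (m ℓ : ℕ) (i : Fin (2 ^ m)) : Type :=
  ({j : Fin (2 ^ m) // j < i} → ZMod 2) × (Fin ℓ → Fin (2 ^ m) → ZMod 2)

/-- Joint density of `U_ℓ^i`, its past `(U_ℓ^{<i}, X_{<ℓ})` and `Y'`. -/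
def bitDensity (m : ℕ) (η vr Δ : ℝ) (ℓ : ℕ) (i : Fin (2 ^ m)) (b : ZMod 2) (s : Past m ℓ i)
    (y : Fin (2 ^ m) → ℝ) : ℝ :=
  ∑' x : Fin (2 ^ m) → ℤ,
    Set.indicator
      {x | polarBits ℓ x i = b ∧ (∀ j, polarBits ℓ x j.1 = s.1 j) ∧
        ∀ k : Fin ℓ, levelBits k x = s.2 k}
      (fun x => jointDensity η vr Δ x y) x

/-- The information set at level `ℓ`: those `i` with
`Z(U_ℓ^i | U_ℓ^{<i}, X_{<ℓ}, Y') < 1 - 2 ^ (-N ^ β)`, where `N = 2 ^ m`. -/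
def infoSet (m : ℕ) (η vr Δ β : ℝ) (ℓ : ℕ) : Set (Fin (2 ^ m)) :=
  {i | bhattacharyya (bitDensity m η vr Δ ℓ i) < 1 - (2 : ℝ) ^ (-((2 : ℝ) ^ m) ^ β)}

/-! ### Construction D -/

/-- The integer vector `∑_{ℓ < r} 2 ^ ℓ ∑_j u_ℓ^j ψ(g_j) + 2 ^ r z`, where `g_j` is the `j`-th row
of `G_N` and `ψ` the natural embedding of `𝔽₂ ^ N` in `ℤ ^ N`. -/
def codeVector (m r : ℕ) (u : ℕ → Fin (2 ^ m) → ℤ) (z : Fin (2 ^ m) → ℤ) : Fin (2 ^ m) → ℤ :=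
  fun i => ∑ ℓ ∈ Finset.range r, 2 ^ ℓ * ∑ j, u ℓ j * ((polarMatrix m j i).val : ℤ) + 2 ^ r * z i

/-- The integer vectors of Construction D: `codeVector` with bits `u_ℓ^j ∈ {0, 1}`, which vanish
for `j ∉ I ℓ`, and `z ∈ ℤ ^ N`. -/
def constructionD (m r : ℕ) (I : ℕ → Set (Fin (2 ^ m))) : Set (Fin (2 ^ m) → ℤ) :=
  {x | ∃ (u : ℕ → Fin (2 ^ m) → ℤ) (z : Fin (2 ^ m) → ℤ),
    (∀ ℓ j, u ℓ j = 0 ∨ (u ℓ j = 1 ∧ j ∈ I ℓ)) ∧ x = codeVector m r u z}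

/-- The Construction D lattice in `ℝ ^ N`, scaled by `η`. The vectors of Construction D form a
group if `I 0 ⊆ I 1 ⊆ ⋯` (see `coe_scaledLattice`); in general this is the lattice they
generate. -/
def scaledLattice (m r : ℕ) (η : ℝ) (I : ℕ → Set (Fin (2 ^ m))) :
    AddSubgroup (EuclideanSpace ℝ (Fin (2 ^ m))) :=
  AddSubgroup.closure
    {v | ∃ x ∈ constructionD m r I, v = η • WithLp.toLp 2 (fun i => (x i : ℝ))}

/-- The quantization lattice `Λ_Q` of dimension `N = 2 ^ m` with top lattice `η ℤ`, bottom lattice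
`η 2 ^ r ℤ`, for source variance `vs`, target distortion `Δ` and polarization exponent `β`; the
reconstruction variance is `vs - Δ`. -/
def quantLattice (m r : ℕ) (η vs Δ β : ℝ) : AddSubgroup (EuclideanSpace ℝ (Fin (2 ^ m))) :=
  scaledLattice m r η (infoSet m η (vs - Δ) Δ β)

/-! ### Voronoi cell and second moment -/

/-- The (closed) Voronoi cell of `Λ` around `0`. -/
def voronoiCell {N : ℕ} (Λ : AddSubgroup (EuclideanSpace ℝ (Fin N))) :
    Set (EuclideanSpace ℝ (Fin N)) :=
  {x | ∀ v ∈ Λ, ‖x‖ ≤ ‖x - v‖}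

/-- The second moment per dimension: the integral of `‖u‖ ^ 2` over the Voronoi cell, divided by
`N` times the volume of the cell. -/
def secondMoment {N : ℕ} (Λ : AddSubgroup (EuclideanSpace ℝ (Fin N))) : ℝ :=
  (∫ u in voronoiCell Λ, ‖u‖ ^ 2) / (N * volume.real (voronoiCell Λ))

/-! ### Nested index sets: Construction D is a group -/

theorem exists_carry (m r : ℕ) (I : ℕ → Set (Fin (2 ^ m))) (hI : Monotone I)
    (c : ℕ → Fin (2 ^ m) → ℤ) (hc : ∀ ℓ j, j ∉ I ℓ → c ℓ j = 0) :
    ∃ (u : ℕ → Fin (2 ^ m) → ℤ) (e : Fin (2 ^ m) → ℤ),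
      (∀ ℓ j, u ℓ j = 0 ∨ (u ℓ j = 1 ∧ j ∈ I ℓ)) ∧ (∀ j, j ∉ I r → e j = 0) ∧
      ∀ j, ∑ ℓ ∈ Finset.range r, 2 ^ ℓ * c ℓ j =
        ∑ ℓ ∈ Finset.range r, 2 ^ ℓ * u ℓ j + 2 ^ r * e j := by
  induction r with
  | zero => exact ⟨fun _ _ => 0, fun _ => 0, by simp, by simp, by simp⟩
  | succ r ih =>
    obtain ⟨u, e, hu, he, h⟩ := ih
    refine ⟨fun ℓ j => if ℓ = r then (e j + c r j) % 2 else u ℓ j,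
      fun j => (e j + c r j) / 2, ?_, ?_, ?_⟩
    · intro ℓ j
      by_cases hl : ℓ = r
      · subst hl
        by_cases hj : j ∈ I ℓ
        · have := Int.emod_two_eq_zero_or_one (e j + c ℓ j)
          simpa [hj] using this
        · simp [he j hj, hc ℓ j hj]
      · simpa [hl] using hu ℓ j
    · intro j hj
      have hj' : j ∉ I r := fun hh => hj (hI (Nat.le_succ r) hh)
      simp [he j hj', hc r j hj']
    · intro j
      rw [Finset.sum_range_succ, Finset.sum_range_succ, h j]
      have h1 : ∑ ℓ ∈ Finset.range r, 2 ^ ℓ * (if ℓ = r then (e j + c r j) % 2 else u ℓ j) =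
          ∑ ℓ ∈ Finset.range r, 2 ^ ℓ * u ℓ j :=
        Finset.sum_congr rfl fun ℓ hl => by
          rw [if_neg (Finset.mem_range.1 hl).ne]
      simp only [h1, if_true]
      have h2 := Int.emod_add_mul_ediv (e j + c r j) 2
      rw [pow_succ]
      linear_combination (-(2 : ℤ) ^ r) * h2

theorem codeVector_mem (m r : ℕ) (I : ℕ → Set (Fin (2 ^ m))) (hI : Monotone I)
    (c : ℕ → Fin (2 ^ m) → ℤ) (hc : ∀ ℓ j, j ∉ I ℓ → c ℓ j = 0) (z : Fin (2 ^ m) → ℤ) :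
    codeVector m r c z ∈ constructionD m r I := by
  obtain ⟨u, e, hu, -, h⟩ := exists_carry m r I hI c hc
  refine ⟨u, fun i => ∑ j, e j * ((polarMatrix m j i).val : ℤ) + z i, hu, ?_⟩
  have key : ∀ (w : ℕ → Fin (2 ^ m) → ℤ) (i : Fin (2 ^ m)),
      ∑ ℓ ∈ Finset.range r, 2 ^ ℓ * ∑ j, w ℓ j * ((polarMatrix m j i).val : ℤ) =
        ∑ j, (∑ ℓ ∈ Finset.range r, 2 ^ ℓ * w ℓ j) * ((polarMatrix m j i).val : ℤ) := by
    intro w i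
    simp only [Finset.mul_sum, Finset.sum_mul]
    rw [Finset.sum_comm]
    exact Finset.sum_congr rfl fun _ _ => Finset.sum_congr rfl fun _ _ => by ring
  funext i
  unfold codeVector
  rw [key, key]
  simp only [h, add_mul, Finset.sum_add_distrib, mul_add, Finset.mul_sum, mul_assoc]
  ring

theorem closure_constructionD (m r : ℕ) (I : ℕ → Set (Fin (2 ^ m))) (hI : Monotone I) :
    (AddSubgroup.closure (constructionD m r I) : Set (Fin (2 ^ m) → ℤ)) = constructionD m r I := by
  refine Set.Subset.antisymm (fun x hx => ?_) AddSubgroup.subset_closure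
  have hu0 : ∀ {u : ℕ → Fin (2 ^ m) → ℤ}, (∀ ℓ j, u ℓ j = 0 ∨ (u ℓ j = 1 ∧ j ∈ I ℓ)) →
      ∀ ℓ j, j ∉ I ℓ → u ℓ j = 0 := fun hu ℓ j hj => (hu ℓ j).resolve_right fun h => hj h.2
  induction hx using AddSubgroup.closure_induction with
  | mem x hx => exact hx
  | zero =>
    have := codeVector_mem m r I hI (fun _ _ => 0) (fun _ _ _ => rfl) 0
    convert this using 1
    funext i
    simp [codeVector]
  | add x y _ _ hx hy =>
    obtain ⟨u, z, hu, rfl⟩ := hx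
    obtain ⟨u', z', hu', rfl⟩ := hy
    have := codeVector_mem m r I hI (fun ℓ j => u ℓ j + u' ℓ j)
      (fun ℓ j hj => by rw [hu0 hu ℓ j hj, hu0 hu' ℓ j hj, add_zero]) (z + z')
    convert this using 1
    funext i
    simp only [codeVector, Pi.add_apply, add_mul, Finset.sum_add_distrib, mul_add]
    ring
  | neg x _ hx =>
    obtain ⟨u, z, hu, rfl⟩ := hx
    have := codeVector_mem m r I hI (fun ℓ j => - u ℓ j)
      (fun ℓ j hj => by rw [hu0 hu ℓ j hj, neg_zero]) (-z)
    convert this using 1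
    funext i
    simp only [codeVector, Pi.neg_apply, neg_mul, Finset.sum_neg_distrib, mul_neg]
    ring

/-- For nested index sets the scaled Construction D vectors already form the lattice that they
generate. -/
theorem coe_scaledLattice (m r : ℕ) (η : ℝ) (I : ℕ → Set (Fin (2 ^ m))) (hI : Monotone I) :
    (scaledLattice m r η I : Set (EuclideanSpace ℝ (Fin (2 ^ m)))) =
      {v | ∃ x ∈ constructionD m r I, v = η • WithLp.toLp 2 (fun i => (x i : ℝ))} := by
  refine Set.Subset.antisymm (fun v hv => ?_) AddSubgroup.subset_closure
  have hcl := closure_constructionD m r I hI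
  change v ∈ AddSubgroup.closure _ at hv
  induction hv using AddSubgroup.closure_induction with
  | mem v hv => exact hv
  | zero =>
    refine ⟨0, hcl ▸ zero_mem (AddSubgroup.closure (constructionD m r I)), ?_⟩
    ext i
    simp
  | add v w _ _ hv hw =>
    obtain ⟨x, hx, rfl⟩ := hv
    obtain ⟨y, hy, rfl⟩ := hw
    rw [← hcl] at hx hy
    refine ⟨x + y, hcl ▸ add_mem (SetLike.mem_coe.1 hx) (SetLike.mem_coe.1 hy), ?_⟩
    ext i
    simp [mul_add]
  | neg v _ hv =>
    obtain ⟨x, hx, rfl⟩ := hv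
    rw [← hcl] at hx
    refine ⟨-x, hcl ▸ neg_mem (SetLike.mem_coe.1 hx), ?_⟩
    ext i
    simp

end PolarLattice

end

/-! Write N = 2 ^ m, vr = vs - Δ, α = vr / (vr + Δ), σ = vr Δ / (vr + Δ); σ is the target second
moment. The polar matrix has determinant 1 over ℤ, so its rows g_j form a basis of ℤ ^ N. Nested or
not, the index sets generate the lattice Λ of all η x whose j-th coordinate in this basis is
divisible by 2 ^ e_j, with e_j the first level below r at which j is an information index, or r if
there is none (`scaledLattice_eq_map`). Every bit (ℓ, j) with ℓ < e_j is frozen, so its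
Bhattacharyya parameter is at least 1 - 2 ^ (-N ^ β).

Gaussian noise is almost uniform modulo Λ. By completing the square and Poisson summation, X - α Y'
is almost Gaussian of variance σ, with error exponentially small in N because 1 / η ^ 2 is of order
N. A frozen bit is almost uniform given its past and Y', and translating X by 2 ^ ℓ g_i flips this
bit and keeps the past. A Λ-periodic test function may therefore be averaged with its translate at
little cost, which gives it a further period (`stageBound_succ`). Once all frozen bits are treated
it has period η ℤ ^ N, and flatness of the Gaussian finishes. Convolution extends the result to
every variance s ≥ σ (`lintegral_gauss_lattice_le`).

Now let B be the set of points at squared distance at least (N - 3) σ from Λ, and p its share of the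
Voronoi cell. All Gaussians of variance s ≥ σ give B nearly the probability p. A change of variance
is a tilt by a power of X = exp (c (‖x‖² / σ - N) / (2 √N)), so B is nearly uncorrelated with 1, X,
X², X³. On B one has X ≥ Z with Z → 1, hence (X - Z) (X - 3)² ≥ 0 there; but the k-th moment of X
tends to (11/10) ^ (k²), so the mean of this cubic tends to a negative number. Hence p is at most a
constant times the error (`eventually_prob_le`), and N² p → 0.

Outside B, points of the cell have squared norm below (N - 3) σ; on B it is at most N², since Λ
contains √N ℤ ^ N. The second moment is thus at most (N - 2) σ / N for large N, which is below N σ /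
(N + 2) even without the additive term. The sizes of the information sets play no role. -/

noncomputable section

namespace PolarLattice

/-! ### The polar matrix over the integers -/

/-- The polar matrix with entries `0, 1` read as integers. -/
def polarMatrixInt (m : ℕ) : Matrix (Fin (2 ^ m)) (Fin (2 ^ m)) ℤ :=
  fun j i => ((polarMatrix m j i).val : ℤ)

theorem polarMatrix_mul_self (m : ℕ) : polarMatrix m * polarMatrix m = 1 := by
  induction m with
  | zero => simp [polarMatrix]
  | succ m ih =>
    have hk : kernel * kernel = 1 := by decide
    have := Matrix.mul_kronecker_mul kernel kernel (polarMatrix m) (polarMatrix m)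
    rw [hk, ih, Matrix.one_kronecker_one] at this
    simp only [polarMatrix, Matrix.reindex_apply, Matrix.submatrix_mul_equiv]
    erw [← this]
    exact Matrix.submatrix_one_equiv
      (finProdFinEquiv.trans (finCongr (pow_succ' 2 m).symm)).symm

theorem polarMatrixInt_succ (m : ℕ) :
    polarMatrixInt (m + 1) =
      Matrix.reindex (finProdFinEquiv.trans (finCongr (pow_succ' 2 m).symm))
        (finProdFinEquiv.trans (finCongr (pow_succ' 2 m).symm))
        (Matrix.kroneckerMap (· * ·) !![1, 0; 1, 1] (polarMatrixInt m)) := by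
  have hv : ∀ a b : ZMod 2, ((a * b).val : ℤ) = (a.val : ℤ) * (b.val : ℤ) := by decide
  have hk : ∀ i j : Fin 2, ((kernel i j).val : ℤ) = (!![1, 0; 1, 1] : Matrix _ _ ℤ) i j := by
    intro i j
    fin_cases i <;> fin_cases j <;> rfl
  ext i j
  simp only [polarMatrixInt, polarMatrix, Matrix.reindex_apply, Matrix.submatrix_apply,
    Matrix.kroneckerMap_apply, hv, hk]

theorem det_polarMatrixInt (m : ℕ) : (polarMatrixInt m).det = 1 := by
  induction m with
  | zero =>
    have : polarMatrixInt 0 = 1 := by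
      ext i j
      fin_cases i; fin_cases j
      simp [polarMatrixInt, polarMatrix, ZMod.val_one]
    simp [this]
  | succ m ih =>
    rw [polarMatrixInt_succ, Matrix.det_reindex_self]
    have := Matrix.det_kronecker (!![1, 0; 1, 1] : Matrix _ _ ℤ) (polarMatrixInt m)
    rw [ih, Matrix.det_fin_two_of] at this
    simpa using this

theorem polarMatrixInt_map (m : ℕ) :
    (polarMatrixInt m).map (Int.castRingHom (ZMod 2)) = polarMatrix m := by
  ext i j
  simp [polarMatrixInt]

theorem polarMatrixInt_inv_map (m : ℕ) :
    (polarMatrixInt m)⁻¹.map (Int.castRingHom (ZMod 2)) = polarMatrix m := by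
  have h : polarMatrixInt m * (polarMatrixInt m)⁻¹ = 1 :=
    Matrix.mul_nonsing_inv _ (by simp [det_polarMatrixInt])
  have h2 := congrArg (fun A => A.map (Int.castRingHom (ZMod 2))) h
  simp only [Matrix.map_mul, polarMatrixInt_map] at h2
  have h3 := congrArg (polarMatrix m * ·) h2
  simpa [← Matrix.mul_assoc, polarMatrix_mul_self, Matrix.map_one] using h3

/-- Coordinates of an integer vector with respect to the rows of the polar matrix. -/
def coord (m : ℕ) : (Fin (2 ^ m) → ℤ) →+ (Fin (2 ^ m) → ℤ) where
  toFun x := Matrix.vecMul x (polarMatrixInt m)⁻¹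
  map_zero' := Matrix.zero_vecMul _
  map_add' x y := Matrix.add_vecMul _ x y

theorem coord_vecMul (m : ℕ) (c : Fin (2 ^ m) → ℤ) :
    coord m (Matrix.vecMul c (polarMatrixInt m)) = c := by
  simp [coord, Matrix.vecMul_vecMul, Matrix.mul_nonsing_inv, det_polarMatrixInt]

theorem vecMul_coord (m : ℕ) (x : Fin (2 ^ m) → ℤ) :
    Matrix.vecMul (coord m x) (polarMatrixInt m) = x := by
  simp [coord, Matrix.vecMul_vecMul, Matrix.nonsing_inv_mul, det_polarMatrixInt]

theorem coord_mul (m : ℕ) (a : ℤ) (x : Fin (2 ^ m) → ℤ) (j : Fin (2 ^ m)) :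
    coord m (fun i => a * x i) j = a * coord m x j := by
  have := congrFun (map_zsmul (coord m) a x) j
  simp only [Pi.smul_apply, smul_eq_mul] at this
  rw [← this]
  rfl

theorem coord_row (m : ℕ) (i : Fin (2 ^ m)) : coord m (polarMatrixInt m i) = Pi.single i 1 := by
  rw [← coord_vecMul m (Pi.single i 1), Matrix.single_one_vecMul]
  rfl

/-- The link between lattice and bits: the polar matrix is its own inverse over `𝔽₂`, so integer
coordinates reduce modulo 2 to the polar transform. -/
theorem coord_cast (m : ℕ) (x : Fin (2 ^ m) → ℤ) (j : Fin (2 ^ m)) :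
    ((coord m x j : ℤ) : ZMod 2) =
      Matrix.vecMul (fun i => (x i : ZMod 2)) (polarMatrix m) j := by
  rw [← polarMatrixInt_inv_map]
  simp [coord, Matrix.vecMul, dotProduct]

/-! ### Lattices between `ℤ ^ N` and `2 ^ r ℤ ^ N` -/

/-- The integer vectors whose `j`-th coordinate is divisible by `2 ^ a j`. -/
def coordLattice (m : ℕ) (a : Fin (2 ^ m) → ℕ) : AddSubgroup (Fin (2 ^ m) → ℤ) where
  carrier := {x | ∀ j, (2 : ℤ) ^ a j ∣ coord m x j}
  zero_mem' j := by simp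
  add_mem' {x y} hx hy j := by
    rw [map_add]
    exact dvd_add (hx j) (hy j)
  neg_mem' {x} hx j := by
    rw [map_neg]
    exact (dvd_neg (α := ℤ)).2 (hx j)

theorem coordLattice_anti {m : ℕ} {a b : Fin (2 ^ m) → ℕ} (h : a ≤ b) :
    coordLattice m b ≤ coordLattice m a :=
  fun _ hx j => (pow_dvd_pow 2 (h j)).trans (hx j)

theorem coordLattice_zero (m : ℕ) : coordLattice m 0 = ⊤ :=
  eq_top_iff.2 fun _ _ j => by simp

theorem pow_mul_mem_coordLattice {m r : ℕ} {a : Fin (2 ^ m) → ℕ} (h : ∀ j, a j ≤ r)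
    (z : Fin (2 ^ m) → ℤ) : (fun i => 2 ^ r * z i) ∈ coordLattice m a := fun j => by
  rw [coord_mul]
  exact (pow_dvd_pow 2 (h j)).mul_right _

/-- The embedding of `ℤ ^ N` in `ℝ ^ N` with scaling factor `η`. -/
def scaledEmb (N : ℕ) (η : ℝ) : (Fin N → ℤ) →+ EuclideanSpace ℝ (Fin N) where
  toFun x := η • WithLp.toLp 2 (fun i => (x i : ℝ))
  map_zero' := by ext; simp
  map_add' x y := by ext; simp [mul_add]

theorem scaledEmb_apply (N : ℕ) (η : ℝ) (x : Fin N → ℤ) (i : Fin N) :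
    scaledEmb N η x i = η * x i := by simp [scaledEmb]

theorem codeVector_eq (m r : ℕ) (u : ℕ → Fin (2 ^ m) → ℤ) (z : Fin (2 ^ m) → ℤ) :
    codeVector m r u z = ∑ ℓ ∈ Finset.range r, ∑ j, u ℓ j • (fun i => 2 ^ ℓ * polarMatrixInt m j i)
      + fun i => 2 ^ r * z i := by
  funext i
  simp only [codeVector, Pi.add_apply, Finset.sum_apply, Pi.smul_apply, smul_eq_mul,
    Finset.mul_sum, polarMatrixInt]
  congr 1
  exact Finset.sum_congr rfl fun _ _ => Finset.sum_congr rfl fun _ _ => by ring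

/-- The first level below `r` at which an index belongs to the index sets, or `r`. -/
theorem exists_firstLevel {m : ℕ} (r : ℕ) (I : ℕ → Set (Fin (2 ^ m))) :
    ∃ e : Fin (2 ^ m) → ℕ, (∀ j, e j ≤ r) ∧ (∀ j, ∀ ℓ < e j, j ∉ I ℓ) ∧
      ∀ j, e j < r → j ∈ I (e j) := by
  have : ∀ j, ∃ k, k ≤ r ∧ (∀ ℓ < k, j ∉ I ℓ) ∧ (k < r → j ∈ I k) := by
    intro j
    induction r with
    | zero => exact ⟨0, le_rfl, by simp, by simp⟩
    | succ r ih =>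
      obtain ⟨k, hk, h1, h2⟩ := ih
      rcases hk.lt_or_eq with h | rfl
      · exact ⟨k, hk.trans (Nat.le_succ r), h1, fun _ => h2 h⟩
      · by_cases hj : j ∈ I k
        · exact ⟨k, Nat.le_succ k, h1, fun _ => hj⟩
        · refine ⟨k + 1, le_rfl, fun ℓ hℓ => ?_, fun h => absurd h (lt_irrefl _)⟩
          rcases (Nat.lt_succ_iff.1 hℓ).lt_or_eq with h | rfl
          exacts [h1 ℓ h, hj]
  choose e h using this
  exact ⟨e, fun j => (h j).1, fun j => (h j).2.1, fun j => (h j).2.2⟩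

/-- Only the first occurrence of an index matters: 2 ^ e_j g_j divides every later generator along
g_j. No nesting is required. -/
theorem scaledLattice_eq_map (m r : ℕ) (η : ℝ) (I : ℕ → Set (Fin (2 ^ m)))
    (e : Fin (2 ^ m) → ℕ) (her : ∀ j, e j ≤ r) (heI : ∀ j, ∀ ℓ < e j, j ∉ I ℓ)
    (hI : ∀ j, e j < r → j ∈ I (e j)) :
    scaledLattice m r η I = (coordLattice m e).map (scaledEmb (2 ^ m) η) := by
  have hset : {v | ∃ x ∈ constructionD m r I, v = η • WithLp.toLp 2 (fun i => (x i : ℝ))} =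
      scaledEmb (2 ^ m) η '' constructionD m r I := by
    ext v
    exact ⟨fun ⟨x, hx, h⟩ => ⟨x, hx, h.symm⟩, fun ⟨x, hx, h⟩ => ⟨x, hx, h.symm⟩⟩
  rw [scaledLattice, hset, ← AddMonoidHom.map_closure]
  congr 1
  refine le_antisymm ((AddSubgroup.closure_le _).2 ?_) fun x hx => ?_
  · rintro x ⟨u, z, hu, rfl⟩
    rw [codeVector_eq]
    refine add_mem (sum_mem fun ℓ _ => sum_mem fun j _ => ?_) (pow_mul_mem_coordLattice her z)
    rcases hu ℓ j with h | ⟨h, hj⟩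
    · simp [h]
    · rw [h, one_smul]
      intro k
      rw [coord_mul, coord_row]
      rcases eq_or_ne k j with rfl | hk
      · simpa using pow_dvd_pow (2 : ℤ) (not_lt.1 fun hlt => heI k ℓ hlt hj)
      · simp [hk]
  · have key : ∀ j, (fun i => 2 ^ e j * polarMatrixInt m j i) ∈
        AddSubgroup.closure (constructionD m r I) := by
      intro j
      apply AddSubgroup.subset_closure
      -- Below r the vector is a Construction D vector with a single bit set; at e_j = r it comes
      -- from the part 2 ^ r z.
      rcases (her j).lt_or_eq with h | h
      · refine ⟨fun ℓ k => if ℓ = e j ∧ k = j then 1 else 0, 0, fun ℓ k => ?_, ?_⟩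
        · by_cases hc : ℓ = e j ∧ k = j
          · right
            obtain ⟨rfl, rfl⟩ := hc
            exact ⟨if_pos ⟨rfl, rfl⟩, hI k h⟩
          · exact Or.inl (if_neg hc)
        · funext i
          simp only [codeVector, ite_mul, one_mul, zero_mul, ite_and, Pi.zero_apply, mul_zero,
            add_zero]
          rw [Finset.sum_eq_single_of_mem (e j) (Finset.mem_range.2 h)
            fun b _ hb => by simp [hb]]
          simp [polarMatrixInt]
      · refine ⟨0, polarMatrixInt m j, fun _ _ => Or.inl rfl, ?_⟩
        funext i
        simp [codeVector, h]
    have hx' : x = ∑ j, (coord m x j / 2 ^ e j) • fun i => 2 ^ e j * polarMatrixInt m j i := by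
      conv_lhs => rw [← vecMul_coord m x]
      funext i
      simp only [Matrix.vecMul, dotProduct, Finset.sum_apply, Pi.smul_apply, smul_eq_mul]
      exact Finset.sum_congr rfl fun j _ => by rw [← mul_assoc, Int.ediv_mul_cancel (hx j)]
    rw [hx']
    exact sum_mem fun j _ => zsmul_mem (key j) _

/-! ### Labels and coordinates -/

/-- Equal lower digits make x - x' equal to 2 ^ ℓ q without carries, q being the difference of the
quotients. Modulo 2, q is the difference of the digits at level ℓ, so its coordinates are
differences of polar bits and are even up to index i. -/
theorem sub_mem_of_polarBits_eq {m ℓ : ℕ} {i : Fin (2 ^ m)} {x x' : Fin (2 ^ m) → ℤ}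
    (hb : ∀ j ≤ i, polarBits ℓ x j = polarBits ℓ x' j)
    (hl : ∀ k < ℓ, levelBits k x = levelBits k x') :
    x - x' ∈ coordLattice m (fun j => if j ≤ i then ℓ + 1 else ℓ) := by
  have hmod : ∀ k ≤ ℓ, ∀ t, x t % 2 ^ k = x' t % 2 ^ k := by
    intro k
    induction k with
    | zero => intro _ t; simp
    | succ k ih =>
      intro hk t
      have h1 := ih (by omega) t
      have h2 := congrFun (hl k (by omega)) t
      simp only [levelBits, levelBit] at h2
      rw [ZMod.intCast_eq_intCast_iff] at h2
      have h3 : ∀ a : ℤ, a % 2 ^ (k + 1) = 2 ^ k * (a / 2 ^ k % 2) + a % 2 ^ k := by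
        intro a
        have e1 := Int.emod_add_mul_ediv a (2 ^ k)
        have e2 := Int.emod_add_mul_ediv a (2 ^ (k + 1))
        have e3 := Int.emod_add_mul_ediv (a / 2 ^ k) 2
        have e4 : a / 2 ^ (k + 1) = a / 2 ^ k / 2 := by
          rw [pow_succ, Int.ediv_ediv_of_nonneg (by positivity)]
        rw [e4, pow_succ] at e2
        rw [pow_succ]
        linear_combination e2 - e1 - (2 : ℤ) ^ k * e3
      rw [h3, h3, h1]
      have h4 : x t / 2 ^ k % 2 = x' t / 2 ^ k % 2 := h2
      rw [h4]
  set q : Fin (2 ^ m) → ℤ := fun t => x t / 2 ^ ℓ - x' t / 2 ^ ℓ with hq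
  have hx : x - x' = fun t => 2 ^ ℓ * q t := by
    funext t
    have e1 := Int.emod_add_mul_ediv (x t) (2 ^ ℓ)
    have e2 := Int.emod_add_mul_ediv (x' t) (2 ^ ℓ)
    have e3 := hmod ℓ le_rfl t
    simp only [Pi.sub_apply, hq]
    linear_combination e2 - e1 + e3
  have hqc : ∀ j ≤ i, (2 : ℤ) ∣ coord m q j := by
    intro j hj
    refine (ZMod.intCast_zmod_eq_zero_iff_dvd _ 2).1 ?_
    rw [coord_cast]
    have h := hb j hj
    have e : (fun t => (q t : ZMod 2)) = levelBits ℓ x - levelBits ℓ x' := by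
      funext t
      simp [hq, levelBits, levelBit]
    simp only [polarBits] at h
    rw [e, Matrix.sub_vecMul, Pi.sub_apply, h, sub_self]
  intro j
  rw [hx, coord_mul]
  beta_reduce
  split_ifs with hj
  · rw [pow_succ]
    exact mul_dvd_mul_left _ (hqc j hj)
  · exact Dvd.intro _ rfl

theorem levelBits_add_row {m ℓ k : ℕ} (hk : k < ℓ) (x q : Fin (2 ^ m) → ℤ) :
    levelBits k (x + fun t => 2 ^ ℓ * q t) = levelBits k x := by
  funext t
  simp only [levelBits, levelBit, Pi.add_apply]
  obtain ⟨d, rfl⟩ := Nat.exists_eq_add_of_lt hk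
  have : (x t + 2 ^ (k + d + 1) * q t) / 2 ^ k = x t / 2 ^ k + 2 * (2 ^ d * q t) := by
    rw [show x t + 2 ^ (k + d + 1) * q t = x t + 2 ^ k * (2 * (2 ^ d * q t)) by ring,
      Int.add_mul_ediv_left _ _ (by positivity)]
  rw [this]
  push_cast
  rw [show (2 : ZMod 2) = 0 from rfl]
  ring

/-- Adding a multiple of 2 ^ ℓ adds without carry at digit ℓ, and g_i times the polar matrix is a
unit vector since the matrix is an involution. -/
theorem polarBits_add_row {m ℓ : ℕ} (i j : Fin (2 ^ m)) (x : Fin (2 ^ m) → ℤ) :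
    polarBits ℓ (x + fun t => 2 ^ ℓ * polarMatrixInt m i t) j =
      polarBits ℓ x j + if j = i then 1 else 0 := by
  have e : levelBits ℓ (x + fun t => 2 ^ ℓ * polarMatrixInt m i t) =
      levelBits ℓ x + polarMatrix m i := by
    funext t
    simp only [levelBits, levelBit, Pi.add_apply]
    rw [Int.add_mul_ediv_left _ _ (by positivity)]
    simp [polarMatrixInt]
  simp only [polarBits, e, Matrix.add_vecMul, Pi.add_apply]
  congr 1
  have := congrFun (congrFun (polarMatrix_mul_self m) i) j
  rw [Matrix.mul_apply_eq_vecMul] at this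
  rw [this, Matrix.one_apply]
  simp [eq_comm]

/-! ### One-dimensional Gaussian densities -/

theorem gaussDensity_eq {c v : ℝ} (hv : 0 ≤ v) (y : ℝ) :
    gaussDensity c v y = (√(2 * Real.pi * v))⁻¹ * Real.exp (-(y - c) ^ 2 / (2 * v)) := by
  simp [gaussDensity, ProbabilityTheory.gaussianPDFReal, hv]

theorem gaussDensity_nonneg (c v y : ℝ) : 0 ≤ gaussDensity c v y :=
  ProbabilityTheory.gaussianPDFReal_nonneg _ _ _

theorem gaussDensity_pos {c v : ℝ} (hv : 0 < v) (y : ℝ) : 0 < gaussDensity c v y :=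
  ProbabilityTheory.gaussianPDFReal_pos _ _ _ (by simpa using hv)

@[fun_prop]
theorem measurable_gaussDensity (c v : ℝ) : Measurable (gaussDensity c v) :=
  ProbabilityTheory.measurable_gaussianPDFReal _ _

theorem lintegral_gaussDensity (c : ℝ) {v : ℝ} (hv : 0 < v) :
    ∫⁻ y, ENNReal.ofReal (gaussDensity c v y) = 1 :=
  ProbabilityTheory.lintegral_gaussianPDFReal_eq_one _ (by simpa using hv)

theorem gaussDensity_neg (v y : ℝ) : gaussDensity 0 v (-y) = gaussDensity 0 v y := by
  simp [gaussDensity, ProbabilityTheory.gaussianPDFReal]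

theorem gaussDensity_eq_sub (c v y : ℝ) : gaussDensity c v y = gaussDensity 0 v (y - c) := by
  simp [gaussDensity, ProbabilityTheory.gaussianPDFReal]

/-- Completing the square in a: prior times likelihood is evidence times posterior, with posterior
variance u v / (u + v). -/
theorem gaussDensity_mul_gaussDensity {u v : ℝ} (hu : 0 < u) (hv : 0 < v) (a y : ℝ) :
    gaussDensity 0 u a * gaussDensity a v y =
      gaussDensity 0 (u + v) y * gaussDensity 0 (u * v / (u + v)) (a - u / (u + v) * y) := by
  have hs : 0 < u + v := add_pos hu hv
  rw [gaussDensity_eq hu.le, gaussDensity_eq hv.le, gaussDensity_eq hs.le,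
    gaussDensity_eq (by positivity)]
  have h1 : (√(2 * Real.pi * u))⁻¹ * (√(2 * Real.pi * v))⁻¹ =
      (√(2 * Real.pi * (u + v)))⁻¹ * (√(2 * Real.pi * (u * v / (u + v))))⁻¹ := by
    rw [← mul_inv, ← mul_inv, ← Real.sqrt_mul (by positivity), ← Real.sqrt_mul (by positivity)]
    congr 2
    field_simp
  have h2 : Real.exp (-(a - 0) ^ 2 / (2 * u)) * Real.exp (-(y - a) ^ 2 / (2 * v)) =
      Real.exp (-(y - 0) ^ 2 / (2 * (u + v))) *
        Real.exp (-(a - u / (u + v) * y - 0) ^ 2 / (2 * (u * v / (u + v)))) := by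
    rw [← Real.exp_add, ← Real.exp_add]
    congr 1
    field_simp
    ring
  rw [mul_mul_mul_comm, h1, h2, mul_mul_mul_comm]

theorem gaussDensity_div {α v : ℝ} (hα : 0 < α) (hv : 0 < v) (y : ℝ) :
    α⁻¹ * gaussDensity 0 v (y / α) = gaussDensity 0 (α ^ 2 * v) y := by
  rw [gaussDensity_eq hv.le, gaussDensity_eq (by positivity), ← mul_assoc, ← mul_inv]
  congr 2
  · rw [show 2 * Real.pi * (α ^ 2 * v) = α ^ 2 * (2 * Real.pi * v) by ring,
      Real.sqrt_mul (sq_nonneg α), Real.sqrt_sq hα.le]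
  · field_simp
    simp

/-! ### Periodized Gaussian densities -/

theorem hasSum_pow_natAbs {q : ℝ} (h0 : 0 ≤ q) (h1 : q < 1) :
    HasSum (fun n : ℤ => q ^ n.natAbs) ((1 + q) / (1 - q)) := by
  have ha : HasSum (fun n : ℕ => q ^ (n : ℤ).natAbs) (1 - q)⁻¹ := by
    simpa using hasSum_geometric_of_lt_one h0 h1
  have hb : HasSum (fun n : ℕ => q ^ (-((n : ℤ) + 1)).natAbs) (q * (1 - q)⁻¹) := by
    have := (hasSum_geometric_of_lt_one h0 h1).mul_left q
    refine this.congr_fun fun n => ?_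
    rw [Int.natAbs_neg, show ((n : ℤ) + 1).natAbs = n + 1 by omega, pow_succ']
  have := HasSum.of_nat_of_neg_add_one (f := fun n : ℤ => q ^ n.natAbs) ha hb
  convert this using 1
  rw [div_eq_mul_inv]
  ring

theorem summable_gaussDensity {v η : ℝ} (hv : 0 < v) (hη : 0 < η) (w : ℝ) :
    Summable fun k : ℤ => gaussDensity 0 v (w + η * k) := by
  simp_rw [gaussDensity_eq hv.le, sub_zero]
  refine Summable.mul_left _ ?_
  have h1 : Real.exp (-(η ^ 2 / (4 * v))) < 1 :=
    (Real.exp_lt_exp.2 (neg_lt_zero.2 (by positivity))).trans_eq Real.exp_zero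
  refine Summable.of_nonneg_of_le (fun _ => (Real.exp_pos _).le) (fun k => ?_)
    ((hasSum_pow_natAbs (Real.exp_pos _).le h1).summable.mul_left (Real.exp (w ^ 2 / (2 * v))))
  rw [← Real.exp_nat_mul, ← Real.exp_add]
  apply Real.exp_le_exp.2
  have h2 : ((k.natAbs : ℕ) : ℝ) ≤ (k : ℝ) ^ 2 := by
    rw [← Int.cast_natCast, ← Int.cast_pow, ← Int.natAbs_sq]
    exact_mod_cast Nat.le_self_pow two_ne_zero _
  have h3 : (k.natAbs : ℝ) * (η ^ 2 / (4 * v)) ≤ (k : ℝ) ^ 2 * (η ^ 2 / (4 * v)) :=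
    mul_le_mul_of_nonneg_right h2 (by positivity)
  have h4 : -(w + η * k) ^ 2 / (2 * v) ≤ w ^ 2 / (2 * v) - (k : ℝ) ^ 2 * (η ^ 2 / (4 * v)) := by
    rw [← sub_nonneg]
    have : w ^ 2 / (2 * v) - (k : ℝ) ^ 2 * (η ^ 2 / (4 * v)) - -(w + η * k) ^ 2 / (2 * v) =
        (2 * w + η * k) ^ 2 / (4 * v) := by
      field_simp
      ring
    rw [this]
    positivity
  linarith

/-- Poisson summation: the zero frequency contributes 1, and frequency n at most exp (-t n²) ≤ q ^
|n| with q = exp (-t). -/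
theorem gaussDensity_periodize {v η : ℝ} (hv : 0 < v) (hη : 0 < η) (w : ℝ) :
    |η * ∑' k : ℤ, gaussDensity 0 v (w + η * k) - 1| ≤
      2 * Real.exp (-(2 * Real.pi ^ 2 * v / η ^ 2)) /
        (1 - Real.exp (-(2 * Real.pi ^ 2 * v / η ^ 2))) := by
  set t := 2 * Real.pi ^ 2 * v / η ^ 2 with ht
  have htpos : 0 < t := by positivity
  set q := Real.exp (-t) with hq
  have hq0 : 0 ≤ q := (Real.exp_pos _).le
  have hq1 : q < 1 := (Real.exp_lt_exp.2 (neg_lt_zero.2 htpos)).trans_eq Real.exp_zero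
  -- With this a and linear coefficient -i w / η, the dual side of the Poisson formula is the
  -- translated Gaussian sum.
  set a : ℝ := 2 * Real.pi * v / η ^ 2 with ha
  have hapos : 0 < a := by positivity
  have hP := Complex.tsum_exp_neg_quadratic (a := (a : ℂ)) (by simpa using hapos)
    (-Complex.I * (w / η : ℝ))
  set f : ℤ → ℂ := fun n => Complex.exp
    (-Real.pi * a * n ^ 2 + 2 * Real.pi * (-Complex.I * (w / η : ℝ)) * n) with hf
  have hfn : ∀ n, ‖f n‖ ≤ q ^ n.natAbs := by
    intro n
    rw [hf, Complex.norm_exp, hq, ← Real.exp_nat_mul]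
    apply Real.exp_le_exp.2
    have : ((-Real.pi * a * n ^ 2 + 2 * Real.pi * (-Complex.I * (w / η : ℝ)) * n : ℂ)).re =
        -(t * n ^ 2) := by
      have e : (-Real.pi * a * n ^ 2 + 2 * Real.pi * (-Complex.I * (w / η : ℝ)) * n : ℂ) =
          ((-Real.pi * a * n ^ 2 : ℝ) : ℂ) + ((-2 * Real.pi * (w / η) * n : ℝ) : ℂ) * Complex.I := by
        push_cast; ring
      rw [e, Complex.add_re, Complex.re_ofReal_mul, Complex.ofReal_re, Complex.I_re, ht, ha]
      field_simp
      ring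
    rw [this]
    have h2 : ((n.natAbs : ℕ) : ℝ) ≤ (n : ℝ) ^ 2 := by
      rw [← Int.cast_natCast, ← Int.cast_pow, ← Int.natAbs_sq]
      exact_mod_cast Nat.le_self_pow two_ne_zero _
    nlinarith
  have hg := hasSum_pow_natAbs hq0 hq1
  have hfs : Summable f := Summable.of_norm_bounded hg.summable hfn
  have hf0 : f 0 = 1 := by simp [hf]
  have hbound : ‖∑' n, f n - 1‖ ≤ 2 * q / (1 - q) := by
    have h1 : HasSum (fun n => f n - (Pi.single (0 : ℤ) (1 : ℂ) : ℤ → ℂ) n) (∑' n, f n - 1) :=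
      hfs.hasSum.sub (hasSum_pi_single 0 1)
    have h2 : HasSum (fun n : ℤ => q ^ n.natAbs - (Pi.single (0 : ℤ) (1 : ℝ) : ℤ → ℝ) n)
        ((1 + q) / (1 - q) - 1) := hg.sub (hasSum_pi_single 0 1)
    have h3 : (1 + q) / (1 - q) - 1 = 2 * q / (1 - q) := by
      have : 1 - q ≠ 0 := by linarith
      field_simp
      ring
    rw [← h1.tsum_eq, ← h3]
    refine tsum_of_norm_bounded h2 fun n => ?_
    rcases eq_or_ne n 0 with rfl | hn
    · simp [hf0]
    · simpa [hn] using hfn n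
  have hterm : ∀ n : ℤ, Complex.exp
      (-Real.pi / a * (n + Complex.I * (-Complex.I * (w / η : ℝ))) ^ 2) =
      ((Real.exp (-(w + η * n) ^ 2 / (2 * v)) : ℝ) : ℂ) := by
    intro n
    rw [Complex.ofReal_exp]
    congr 1
    have : Complex.I * (-Complex.I * (w / η : ℝ)) = ((w / η : ℝ) : ℂ) := by
      rw [← mul_assoc, mul_neg, Complex.I_mul_I]; simp
    rw [this, ha]
    norm_cast
    field_simp
    ring
  have hpre : (1 / (a : ℂ) ^ (1 / 2 : ℂ)) = ((η * (√(2 * Real.pi * v))⁻¹ : ℝ) : ℂ) := by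
    have h1 : ((1 / 2 : ℝ) : ℂ) = (1 / 2 : ℂ) := by push_cast; rfl
    rw [← h1, ← Complex.ofReal_cpow hapos.le, ← Real.sqrt_eq_rpow, ha,
      Real.sqrt_div (by positivity), Real.sqrt_sq hη.le]
    rw [← Complex.ofReal_one, ← Complex.ofReal_div]
    congr 1
    field_simp
  have hsum : ∑' n, f n = ((η * ∑' k : ℤ, gaussDensity 0 v (w + η * k) : ℝ) : ℂ) := by
    rw [hP]
    simp_rw [hterm, hpre, gaussDensity_eq hv.le, sub_zero]
    rw [tsum_mul_left, ← Complex.ofReal_tsum, ← Complex.ofReal_mul]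
    congr 1
    ring
  rw [hsum, ← Complex.ofReal_one, ← Complex.ofReal_sub, Complex.norm_real] at hbound
  exact hbound

/-! ### Sums over `ℤ ^ N` of products -/

theorem tsum_pi_prod {N : ℕ} (f : Fin N → ℤ → ENNReal) :
    ∑' x : Fin N → ℤ, ∏ i, f i (x i) = ∏ i, ∑' k, f i k := by
  induction N with
  | zero => simp [tsum_fintype]
  | succ N ih =>
    rw [← (Fin.consEquiv fun _ : Fin (N + 1) => ℤ).tsum_eq, ENNReal.tsum_prod',
      Fin.prod_univ_succ, ← ih fun i => f i.succ, ← ENNReal.tsum_mul_right]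
    refine tsum_congr fun k => ?_
    rw [← ENNReal.tsum_mul_left]
    refine tsum_congr fun x => ?_
    rw [Fin.prod_univ_succ]
    simp [Fin.consEquiv]

theorem lintegral_pi_prod {N : ℕ} (f : Fin N → ℝ → ENNReal) (hf : ∀ i, Measurable (f i)) :
    ∫⁻ x : Fin N → ℝ, ∏ i, f i (x i) = ∏ i, ∫⁻ t, f i t := by
  induction N with
  | zero => simp [volume_pi, Measure.pi_empty_univ]
  | succ N ih =>
    have hmp := (volume_preserving_piFinSuccAbove (fun _ : Fin (N + 1) => ℝ) 0).symm
    rw [← hmp.lintegral_comp_emb (MeasurableEquiv.measurableEmbedding _), Fin.prod_univ_succ, ← ih _ fun i => hf i.succ,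
      Measure.volume_eq_prod, ← lintegral_prod_mul (hf 0).aemeasurable]
    · refine lintegral_congr fun x => ?_
      rw [Fin.prod_univ_succ]
      simp [MeasurableEquiv.piFinSuccAbove]
    · exact (Finset.measurable_fun_prod _ fun i _ =>
        (hf i.succ).comp (measurable_pi_apply i)).aemeasurable

/-! ### Gaussian densities on `ℝ ^ N` -/

/-- Density of `N` independent centred Gaussian variables of variance `s`. -/
def gauss {N : ℕ} (s : ℝ) (x : EuclideanSpace ℝ (Fin N)) : ℝ := ∏ i, gaussDensity 0 s (x i)

theorem gauss_nonneg {N : ℕ} (s : ℝ) (x : EuclideanSpace ℝ (Fin N)) : 0 ≤ gauss s x :=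
  Finset.prod_nonneg fun _ _ => gaussDensity_nonneg _ _ _

@[fun_prop]
theorem measurable_gauss {N : ℕ} (s : ℝ) :
    Measurable (gauss s : EuclideanSpace ℝ (Fin N) → ℝ) := by
  unfold gauss
  fun_prop

theorem gauss_neg {N : ℕ} (s : ℝ) (x : EuclideanSpace ℝ (Fin N)) : gauss s (-x) = gauss s x := by
  simp [gauss, gaussDensity_neg]

theorem gauss_eq {N : ℕ} {s : ℝ} (hs : 0 < s) (x : EuclideanSpace ℝ (Fin N)) :
    gauss s x = (√(2 * Real.pi * s))⁻¹ ^ N * Real.exp (-‖x‖ ^ 2 / (2 * s)) := by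
  simp only [gauss, gaussDensity_eq hs.le, Finset.prod_mul_distrib, Finset.prod_const,
    Finset.card_univ, Fintype.card_fin, ← Real.exp_sum, EuclideanSpace.norm_sq_eq, sub_zero]
  congr 2
  rw [← Finset.sum_div, Finset.sum_neg_distrib]
  simp

theorem lintegral_gauss {N : ℕ} {s : ℝ} (hs : 0 < s) :
    ∫⁻ x : EuclideanSpace ℝ (Fin N), ENNReal.ofReal (gauss s x) = 1 := by
  rw [← (PiLp.volume_preserving_toLp (Fin N)).lintegral_comp (by fun_prop)]
  simp only [gauss]
  simp_rw [ENNReal.ofReal_prod_of_nonneg fun _ _ => gaussDensity_nonneg _ _ _]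
  rw [lintegral_pi_prod (fun _ t => ENNReal.ofReal (gaussDensity 0 s t)) fun _ => by fun_prop]
  simp [lintegral_gaussDensity 0 hs]

theorem gauss_mul_gauss {N : ℕ} {u v : ℝ} (hu : 0 < u) (hv : 0 < v)
    (a y : EuclideanSpace ℝ (Fin N)) :
    gauss u a * gauss v (y - a) =
      gauss (u + v) y * gauss (u * v / (u + v)) (a - (u / (u + v)) • y) := by
  simp only [gauss, ← Finset.prod_mul_distrib]
  refine Finset.prod_congr rfl fun i _ => ?_
  have := gaussDensity_mul_gaussDensity hu hv (a i) (y i)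
  rw [gaussDensity_eq_sub (a i) v] at this
  simpa using this

/-- A Gaussian of variance `u + v` is the sum of independent Gaussians of variance `u`, `v`. -/
theorem lintegral_gauss_add {N : ℕ} {u v : ℝ} (hu : 0 < u) (hv : 0 < v)
    {ψ : EuclideanSpace ℝ (Fin N) → ENNReal} (hψ : Measurable ψ) :
    ∫⁻ x, ENNReal.ofReal (gauss (u + v) x) * ψ x =
      ∫⁻ w, ENNReal.ofReal (gauss v w) * ∫⁻ x, ENNReal.ofReal (gauss u x) * ψ (x + w) := by
  have h1 : ∀ w : EuclideanSpace ℝ (Fin N),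
      ENNReal.ofReal (gauss v w) * ∫⁻ x, ENNReal.ofReal (gauss u x) * ψ (x + w) =
        ∫⁻ x, ENNReal.ofReal (gauss v w) * (ENNReal.ofReal (gauss u (x - w)) * ψ x) := by
    intro w
    rw [← lintegral_const_mul _ (by fun_prop), ← lintegral_sub_right_eq_self _ w]
    simp
  simp_rw [h1]
  rw [lintegral_lintegral_swap (by fun_prop)]
  refine lintegral_congr fun x => ?_
  have h2 : ∀ w, ENNReal.ofReal (gauss v w) * (ENNReal.ofReal (gauss u (x - w)) * ψ x) =
      ENNReal.ofReal (gauss (v * u / (v + u)) (w - (v / (v + u)) • x)) *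
        (ENNReal.ofReal (gauss (u + v) x) * ψ x) := by
    intro w
    rw [← mul_assoc, ← ENNReal.ofReal_mul (gauss_nonneg _ _), gauss_mul_gauss hv hu, ← mul_assoc,
      ← ENNReal.ofReal_mul (gauss_nonneg _ _), add_comm v u, mul_comm (gauss _ x)]
  simp_rw [h2]
  rw [lintegral_mul_const _ (by fun_prop), lintegral_sub_right_eq_self
    (fun w => ENNReal.ofReal (gauss (v * u / (v + u)) w)), lintegral_gauss (by positivity), one_mul]

/-- The sum of the Gaussian density of variance `v` over translates of `η ℤ` is constant up to
a relative error `d`. -/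
def IsFlat (η d v : ℝ) : Prop := ∀ w : ℝ, |η * ∑' k : ℤ, gaussDensity 0 v (w + η * k) - 1| ≤ d

theorem tsum_gauss_eq {N : ℕ} {η v : ℝ} (hη : 0 < η) (hv : 0 < v)
    (w : EuclideanSpace ℝ (Fin N)) :
    ∑' x : Fin N → ℤ, ENNReal.ofReal (gauss v (w + scaledEmb N η x)) =
      ENNReal.ofReal (∏ i, ∑' k : ℤ, gaussDensity 0 v (w i + η * k)) := by
  rw [ENNReal.ofReal_prod_of_nonneg fun _ _ => tsum_nonneg fun _ => gaussDensity_nonneg _ _ _]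
  simp_rw [ENNReal.ofReal_tsum_of_nonneg (fun _ => gaussDensity_nonneg _ _ _)
    (summable_gaussDensity hv hη _)]
  rw [← tsum_pi_prod (fun i k => ENNReal.ofReal (gaussDensity 0 v (w i + η * k)))]
  refine tsum_congr fun x => ?_
  rw [gauss, ENNReal.ofReal_prod_of_nonneg fun _ _ => gaussDensity_nonneg _ _ _]
  simp [scaledEmb_apply]

theorem IsFlat.tsum_le {η d v : ℝ} (h : IsFlat η d v) (hη : 0 < η) (w : ℝ) :
    ∑' k : ℤ, gaussDensity 0 v (w + η * k) ≤ (1 + d) / η := by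
  rw [le_div_iff₀ hη]
  linarith [(abs_le.1 (h w)).2]

theorem IsFlat.le_tsum {η d v : ℝ} (h : IsFlat η d v) (hη : 0 < η) (w : ℝ) :
    (1 - d) / η ≤ ∑' k : ℤ, gaussDensity 0 v (w + η * k) := by
  rw [div_le_iff₀ hη]
  linarith [(abs_le.1 (h w)).1]

theorem IsFlat.tsum_gauss_le {N : ℕ} {η d v : ℝ} (h : IsFlat η d v) (hη : 0 < η) (hv : 0 < v)
    (w : EuclideanSpace ℝ (Fin N)) :
    ∑' x : Fin N → ℤ, ENNReal.ofReal (gauss v (w + scaledEmb N η x)) ≤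
      ENNReal.ofReal (((1 + d) / η) ^ N) := by
  rw [tsum_gauss_eq hη hv]
  refine ENNReal.ofReal_le_ofReal ((Finset.prod_le_prod
    (fun _ _ => tsum_nonneg fun _ => gaussDensity_nonneg _ _ _)
    fun i _ => h.tsum_le hη (w i)).trans_eq (by simp [div_pow]))

theorem IsFlat.le_tsum_gauss {N : ℕ} {η d v : ℝ} (h : IsFlat η d v) (hη : 0 < η) (hv : 0 < v)
    (hd : d < 1) (w : EuclideanSpace ℝ (Fin N)) :
    ENNReal.ofReal (((1 - d) / η) ^ N) ≤
      ∑' x : Fin N → ℤ, ENNReal.ofReal (gauss v (w + scaledEmb N η x)) := by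
  rw [tsum_gauss_eq hη hv]
  refine ENNReal.ofReal_le_ofReal (le_trans (by simp [div_pow]) (Finset.prod_le_prod
    (fun _ _ => div_nonneg (by linarith) hη.le) fun i _ => h.le_tsum hη (w i)))

/-! ### The test channel -/

theorem jointDensity_nonneg {N : ℕ} (η vr Δ : ℝ) (x : Fin N → ℤ) (y : Fin N → ℝ) :
    0 ≤ jointDensity η vr Δ x y :=
  Finset.prod_nonneg fun _ _ => mul_nonneg
    (div_nonneg (gaussDensity_nonneg _ _ _) (tsum_nonneg fun _ => gaussDensity_nonneg _ _ _))
    (gaussDensity_nonneg _ _ _)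

@[fun_prop]
theorem measurable_jointDensity {N : ℕ} (η vr Δ : ℝ) (x : Fin N → ℤ) :
    Measurable (jointDensity η vr Δ x : (Fin N → ℝ) → ℝ) := by
  unfold jointDensity
  fun_prop

theorem jointDensity_eq {N : ℕ} {η vr Δ : ℝ} (hr : 0 < vr) (hΔ : 0 < Δ) (x : Fin N → ℤ)
    (y : EuclideanSpace ℝ (Fin N)) :
    jointDensity η vr Δ x y.ofLp = (∑' k : ℤ, gaussDensity 0 vr (η * k))⁻¹ ^ N *
      (gauss (vr + Δ) y *
        gauss (vr * Δ / (vr + Δ)) (scaledEmb N η x - (vr / (vr + Δ)) • y)) := by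
  rw [← gauss_mul_gauss hr hΔ]
  simp only [jointDensity, discreteGaussian, gauss, div_eq_inv_mul, Finset.prod_mul_distrib,
    Finset.prod_const, Finset.card_univ, Fintype.card_fin, mul_assoc]
  congr 3
  funext i
  rw [gaussDensity_eq_sub, PiLp.sub_apply, scaledEmb_apply]

theorem lintegral_jointDensity {N : ℕ} {η vr Δ : ℝ} (hη : 0 < η) (hr : 0 < vr) (hΔ : 0 < Δ) :
    ∫⁻ y : Fin N → ℝ, ∑' x : Fin N → ℤ, ENNReal.ofReal (jointDensity η vr Δ x y) = 1 := by
  have hS : Summable fun k : ℤ => gaussDensity 0 vr (η * k) := by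
    simpa using summable_gaussDensity hr hη 0
  have hpos : 0 < ∑' k : ℤ, gaussDensity 0 vr (η * k) :=
    hS.tsum_pos (fun _ => gaussDensity_nonneg _ _ _) 0 (gaussDensity_pos hr _)
  have h1 : ∀ n, 0 ≤ discreteGaussian η vr n := fun n =>
    div_nonneg (gaussDensity_nonneg _ _ _) hpos.le
  have h2 : ∑' n : ℤ, ENNReal.ofReal (discreteGaussian η vr n) = 1 := by
    rw [← ENNReal.ofReal_tsum_of_nonneg h1 (hS.div_const _)]
    simp only [discreteGaussian]
    rw [tsum_div_const, div_self hpos.ne', ENNReal.ofReal_one]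
  rw [lintegral_tsum fun x => by fun_prop]
  have h3 : ∀ x : Fin N → ℤ, ∫⁻ y : Fin N → ℝ, ENNReal.ofReal (jointDensity η vr Δ x y) =
      ∏ i, ENNReal.ofReal (discreteGaussian η vr (x i)) := by
    intro x
    simp only [jointDensity]
    simp_rw [ENNReal.ofReal_prod_of_nonneg fun i _ =>
      mul_nonneg (h1 (x i)) (gaussDensity_nonneg _ _ _)]
    rw [lintegral_pi_prod (fun i t => ENNReal.ofReal
      (discreteGaussian η vr (x i) * gaussDensity (η * x i) Δ t)) fun _ => by fun_prop]
    refine Finset.prod_congr rfl fun i _ => ?_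
    simp_rw [ENNReal.ofReal_mul (h1 (x i))]
    rw [lintegral_const_mul _ (by fun_prop), lintegral_gaussDensity _ hΔ, mul_one]
  simp_rw [h3]
  rw [tsum_pi_prod fun _ n => ENNReal.ofReal (discreteGaussian η vr n)]
  simp [h2]

/-- The expectation of `ψ (X - α Y')` under the test channel, `α = vr / (vr + Δ)`. -/
def testChannel {N : ℕ} (η vr Δ : ℝ) (ψ : EuclideanSpace ℝ (Fin N) → ENNReal) : ENNReal :=
  ∫⁻ y : EuclideanSpace ℝ (Fin N), ∑' x : Fin N → ℤ,
    ENNReal.ofReal (jointDensity η vr Δ x y.ofLp) *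
      ψ (scaledEmb N η x - (vr / (vr + Δ)) • y)

theorem lintegral_eq_smul_sub {N : ℕ} {α : ℝ} (hα : 0 < α) (a : EuclideanSpace ℝ (Fin N))
    {F : EuclideanSpace ℝ (Fin N) → ENNReal} (hF : Measurable F) :
    ∫⁻ y, F y = ENNReal.ofReal (α⁻¹ ^ N) * ∫⁻ w, F (α⁻¹ • (a - w)) := by
  rw [lintegral_sub_left_eq_self (fun w => F (α⁻¹ • w)) a,
    ← lintegral_map hF (measurable_const_smul _), Measure.map_addHaar_smul _ (by positivity),
    lintegral_smul_measure, smul_eq_mul, ← mul_assoc, ← ENNReal.ofReal_mul (by positivity)]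
  simp only [finrank_euclideanSpace, Fintype.card_fin]
  rw [abs_of_pos (by positivity), mul_inv_cancel₀ (by positivity), ENNReal.ofReal_one, one_mul]

/-- Substitute y = α⁻¹ (η x - w). The posterior density no longer depends on x, and the evidence
becomes a Gaussian of variance α² (vr + Δ) summed over translates, which flatness makes almost
constant. -/
theorem testChannel_eq {N : ℕ} {η vr Δ : ℝ} (hr : 0 < vr) (hΔ : 0 < Δ)
    {ψ : EuclideanSpace ℝ (Fin N) → ENNReal} (hψ : Measurable ψ) :
    testChannel η vr Δ ψ =
      ∫⁻ w, ENNReal.ofReal ((∑' k : ℤ, gaussDensity 0 vr (η * k))⁻¹ ^ N) *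
        (∑' x : Fin N → ℤ, ENNReal.ofReal
          (gauss ((vr / (vr + Δ)) ^ 2 * (vr + Δ)) (w + scaledEmb N η x))) *
        (ENNReal.ofReal (gauss (vr * Δ / (vr + Δ)) w) * ψ w) := by
  have hα : 0 < vr / (vr + Δ) := by positivity
  have hΘ : 0 ≤ (∑' k : ℤ, gaussDensity 0 vr (η * k))⁻¹ ^ N :=
    pow_nonneg (inv_nonneg.2 (tsum_nonneg fun _ => gaussDensity_nonneg _ _ _)) _
  simp only [testChannel]
  rw [lintegral_tsum fun x => by fun_prop]
  simp_rw [← ENNReal.tsum_mul_left, ← ENNReal.tsum_mul_right]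
  rw [lintegral_tsum fun x => by fun_prop, ← (Equiv.neg (Fin N → ℤ)).tsum_eq]
  refine tsum_congr fun x => ?_
  rw [lintegral_eq_smul_sub hα (scaledEmb N η (-x)) (by fun_prop),
    ← lintegral_const_mul _ (by fun_prop)]
  refine lintegral_congr fun w => ?_
  have h1 : scaledEmb N η (-x) - (vr / (vr + Δ)) • (vr / (vr + Δ))⁻¹ • (scaledEmb N η (-x) - w) =
      w := by
    rw [smul_inv_smul₀ hα.ne', sub_sub_cancel]
  have h2 : (vr / (vr + Δ))⁻¹ ^ N * gauss (vr + Δ) ((vr / (vr + Δ))⁻¹ • (scaledEmb N η (-x) - w)) =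
      gauss ((vr / (vr + Δ)) ^ 2 * (vr + Δ)) (w + scaledEmb N η x) := by
    rw [← gauss_neg _ (w + scaledEmb N η x)]
    simp only [gauss]
    rw [← Fin.prod_const, ← Finset.prod_mul_distrib]
    refine Finset.prod_congr rfl fun i _ => ?_
    rw [← gaussDensity_div hα (by positivity)]
    congr 2
    simp only [map_neg, PiLp.neg_apply, PiLp.smul_apply, PiLp.sub_apply, PiLp.add_apply,
      smul_eq_mul]
    ring
  simp only [Equiv.neg_apply]
  rw [jointDensity_eq hr hΔ, h1, ← h2, ENNReal.ofReal_mul hΘ, ENNReal.ofReal_mul (gauss_nonneg _ _),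
    ENNReal.ofReal_mul (by positivity)]
  ring

/-- Per coordinate, the periodized evidence is at most (1 + d) / η and the normalizing sum at least
(1 - d) / η; the converse `le_testChannel` exchanges the two bounds. -/
theorem testChannel_le {N : ℕ} {η d vr Δ : ℝ} (hη : 0 < η) (hr : 0 < vr) (hΔ : 0 < Δ) (hd : d < 1)
    (h1 : IsFlat η d vr) (h2 : IsFlat η d ((vr / (vr + Δ)) ^ 2 * (vr + Δ)))
    {ψ : EuclideanSpace ℝ (Fin N) → ENNReal} (hψ : Measurable ψ) :
    testChannel η vr Δ ψ ≤ ENNReal.ofReal (((1 + d) / (1 - d)) ^ N) *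
      ∫⁻ w, ENNReal.ofReal (gauss (vr * Δ / (vr + Δ)) w) * ψ w := by
  have hT : (1 - d) / η ≤ ∑' k : ℤ, gaussDensity 0 vr (η * k) := by
    simpa using h1.le_tsum hη 0
  have hd' : 0 < 1 - d := by linarith
  have hd0 : 0 ≤ d := (abs_nonneg _).trans (h1 0)
  have hT0 : 0 < ∑' k : ℤ, gaussDensity 0 vr (η * k) := (div_pos hd' hη).trans_le hT
  rw [testChannel_eq hr hΔ hψ, ← lintegral_const_mul _ (by fun_prop)]
  refine lintegral_mono fun w => mul_le_mul_left ?_ _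
  refine (mul_le_mul_right (h2.tsum_gauss_le hη (by positivity) w) _).trans ?_
  rw [← ENNReal.ofReal_mul (by positivity), ← mul_pow]
  refine ENNReal.ofReal_le_ofReal (pow_le_pow_left₀ (by positivity) ?_ _)
  rw [inv_mul_eq_div, div_le_div_iff₀ hT0 hd', div_mul_eq_mul_div, div_le_iff₀ hη]
  rw [div_le_iff₀ hη] at hT
  nlinarith

theorem le_testChannel {N : ℕ} {η d vr Δ : ℝ} (hη : 0 < η) (hr : 0 < vr) (hΔ : 0 < Δ) (hd : d < 1)
    (h1 : IsFlat η d vr) (h2 : IsFlat η d ((vr / (vr + Δ)) ^ 2 * (vr + Δ)))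
    {ψ : EuclideanSpace ℝ (Fin N) → ENNReal} (hψ : Measurable ψ) :
    ∫⁻ w, ENNReal.ofReal (gauss (vr * Δ / (vr + Δ)) w) * ψ w ≤
      ENNReal.ofReal (((1 + d) / (1 - d)) ^ N) * testChannel η vr Δ ψ := by
  have hT : ∑' k : ℤ, gaussDensity 0 vr (η * k) ≤ (1 + d) / η := by
    simpa using h1.tsum_le hη 0
  have hd' : 0 < 1 - d := by linarith
  have hd0 : 0 ≤ d := (abs_nonneg _).trans (h1 0)
  have hT0 : 0 < ∑' k : ℤ, gaussDensity 0 vr (η * k) := by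
    refine (div_pos hd' hη).trans_le ?_
    simpa using h1.le_tsum hη 0
  rw [testChannel_eq hr hΔ hψ, ← lintegral_const_mul' _ _ ENNReal.ofReal_ne_top]
  refine lintegral_mono fun w => ?_
  rw [← mul_assoc]
  refine le_mul_of_one_le_left' ?_
  refine le_trans ?_ (mul_le_mul_right (mul_le_mul_right
    (h2.le_tsum_gauss hη (by positivity) hd w) _) _)
  rw [← ENNReal.ofReal_mul (by positivity), ← ENNReal.ofReal_mul (by positivity), ← mul_pow,
    ← mul_pow, ← ENNReal.ofReal_one]
  refine ENNReal.ofReal_le_ofReal (one_le_pow₀ ?_)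
  rw [inv_mul_eq_div, div_div, div_mul_div_comm, mul_comm (1 - d) (η * _), mul_div_mul_right _ _ hd'.ne',
    le_div_iff₀ (by positivity), one_mul]
  rw [le_div_iff₀ hη] at hT
  linarith

/-! ### Voronoi cells as fundamental domains -/

section Voronoi

open scoped Pointwise

variable {N : ℕ} {η : ℝ} {Λ : AddSubgroup (EuclideanSpace ℝ (Fin N))}

theorem scaledEmb_injective (hη : 0 < η) : Function.Injective (scaledEmb N η) := by
  intro x y h
  funext i
  have := congrArg (fun v => v.ofLp i) h
  simp only [scaledEmb_apply] at this
  exact_mod_cast mul_left_cancel₀ hη.ne' this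

theorem le_dist_scaledEmb (hη : 0 < η) {x y : Fin N → ℤ} (h : x ≠ y) :
    η ≤ dist (scaledEmb N η x) (scaledEmb N η y) := by
  obtain ⟨i, hi⟩ := Function.ne_iff.1 h
  rw [dist_eq_norm]
  refine le_trans ?_ (PiLp.norm_apply_le _ i)
  rw [PiLp.sub_apply, scaledEmb_apply, scaledEmb_apply, ← mul_sub, Real.norm_eq_abs, abs_mul,
    abs_of_pos hη]
  have : (1 : ℝ) ≤ |(x i : ℝ) - y i| := by
    exact_mod_cast Int.one_le_abs (sub_ne_zero.2 hi)
  nlinarith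

theorem isClosed_of_le_range (hη : 0 < η) (hΛ : Λ ≤ (scaledEmb N η).range) :
    IsClosed (Λ : Set (EuclideanSpace ℝ (Fin N))) := by
  refine Metric.isClosed_of_pairwise_le_dist hη fun v hv w hw hne => ?_
  obtain ⟨x, rfl⟩ := hΛ hv
  obtain ⟨y, rfl⟩ := hΛ hw
  exact le_dist_scaledEmb hη fun h => hne (h ▸ rfl)

theorem countable_of_le_range (hΛ : Λ ≤ (scaledEmb N η).range) : Countable Λ :=
  ((Set.countable_range (scaledEmb N η)).mono hΛ).to_subtype

theorem isClosed_voronoiCell : IsClosed (voronoiCell Λ) := by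
  simp only [voronoiCell, Set.ofPred_forall]
  exact isClosed_biInter fun v _ => isClosed_le (by fun_prop) (by fun_prop)

/-- A nearest lattice point exists because the lattice is closed, and two cells overlap only in a
bisecting hyperplane, which is null. -/
theorem isAddFundamentalDomain_voronoiCell (hη : 0 < η) (hΛ : Λ ≤ (scaledEmb N η).range) :
    IsAddFundamentalDomain Λ (voronoiCell Λ) := by
  refine IsAddFundamentalDomain.mk'' isClosed_voronoiCell.measurableSet.nullMeasurableSet
    (ae_of_all _ fun x => ?_) (fun g hg => ?_) fun g =>
      (measurePreserving_vadd g volume).quasiMeasurePreserving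
  · obtain ⟨v, hv, h⟩ := (isClosed_of_le_range hη hΛ).exists_infDist_eq_dist ⟨0, zero_mem Λ⟩ x
    refine ⟨-⟨v, hv⟩, fun w hw => ?_⟩
    have h1 := Metric.infDist_le_dist_of_mem (x := x) (add_mem hv hw)
    rw [h, dist_eq_norm, dist_eq_norm] at h1
    have h2 : (-⟨v, hv⟩ : Λ) +ᵥ x = x - v := by
      rw [AddSubgroup.vadd_def, vadd_eq_add]
      simp [sub_eq_add_neg, add_comm]
    rw [h2, sub_sub]
    exact h1
  · have hsub : (g +ᵥ voronoiCell Λ) ∩ voronoiCell Λ ⊆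
        (AffineSubspace.perpBisector 0 (g : EuclideanSpace ℝ (Fin N)) : Set _) := by
      rintro x ⟨⟨y, hy, rfl⟩, hx⟩
      have h1 := hx g g.2
      have h2 := hy (-g) (neg_mem g.2)
      simp only [AddSubgroup.vadd_def, vadd_eq_add] at h1 ⊢
      rw [SetLike.mem_coe, AffineSubspace.mem_perpBisector_iff_dist_eq, dist_zero_right,
        dist_eq_norm]
      refine le_antisymm h1 ?_
      rw [add_sub_cancel_left]
      rwa [sub_neg_eq_add, add_comm] at h2
    refine measure_mono_null hsub (Measure.addHaar_affineSubspace _ _ fun htop => hg ?_)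
    have : (0 : EuclideanSpace ℝ (Fin N)) ∈
        AffineSubspace.perpBisector 0 (g : EuclideanSpace ℝ (Fin N)) := htop ▸ trivial
    rw [AffineSubspace.mem_perpBisector_iff_dist_eq, dist_self, dist_zero_left] at this
    exact Subtype.ext (norm_eq_zero.1 this.symm)

/-- Compare u with the point of t ℤ ^ N obtained by rounding each coordinate. -/
theorem norm_sq_le_of_mem_voronoiCell {t : ℝ} (ht : 0 < t)
    (hΛ : ∀ z : Fin N → ℤ, scaledEmb N t z ∈ Λ) {u : EuclideanSpace ℝ (Fin N)}
    (hu : u ∈ voronoiCell Λ) : ‖u‖ ^ 2 ≤ N * t ^ 2 := by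
  refine (pow_le_pow_left₀ (norm_nonneg _) (hu _ (hΛ fun i => round (u i / t))) 2).trans ?_
  rw [EuclideanSpace.norm_sq_eq]
  refine (Finset.sum_le_card_nsmul _ _ (t ^ 2) fun i _ => ?_).trans_eq (by simp)
  rw [PiLp.sub_apply, scaledEmb_apply, Real.norm_eq_abs, sq_abs]
  have h1 := abs_sub_round (u i / t)
  have h2 : u i - t * round (u i / t) = t * (u i / t - round (u i / t)) := by
    field_simp
  rw [h2, mul_pow]
  have h3 : (u i / t - round (u i / t)) ^ 2 ≤ 1 := by
    rw [sq_le_one_iff_abs_le_one]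
    linarith
  nlinarith [sq_nonneg t]

theorem volume_voronoiCell_ne_top {t : ℝ} (ht : 0 < t)
    (hΛ : ∀ z : Fin N → ℤ, scaledEmb N t z ∈ Λ) : volume (voronoiCell Λ) ≠ ⊤ := by
  have : voronoiCell Λ ⊆ Metric.closedBall 0 √(N * t ^ 2) := fun u hu => by
    rw [mem_closedBall_zero_iff]
    exact Real.le_sqrt_of_sq_le (norm_sq_le_of_mem_voronoiCell ht hΛ hu)
  exact ((measure_mono this).trans_lt measure_closedBall_lt_top).ne

/-- A translate of a fundamental domain is again one, since the group is commutative. -/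
theorem setLIntegral_add_right [Countable Λ] {F : Set (EuclideanSpace ℝ (Fin N))}
    (hF : IsAddFundamentalDomain Λ F) {ψ : EuclideanSpace ℝ (Fin N) → ENNReal}
    (hper : ∀ v ∈ Λ, ∀ x, ψ (x + v) = ψ x) (w : EuclideanSpace ℝ (Fin N)) :
    ∫⁻ x in F, ψ (x + w) = ∫⁻ x in F, ψ x := by
  have h1 := (measurePreserving_add_right (volume : Measure (EuclideanSpace ℝ (Fin N)))
    w).setLIntegral_comp_emb (measurableEmbedding_addRight w) ψ F
  have h2 : IsAddFundamentalDomain Λ (w +ᵥ F) := hF.vadd_of_comm w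
  have h3 : (fun x => x + w) '' F = w +ᵥ F := by
    ext x
    simp only [Set.mem_image, Set.mem_vadd_set, vadd_eq_add, add_comm]
  rw [h1, h3]
  refine h2.setLIntegral_eq hF ψ fun g x => ?_
  rw [AddSubgroup.vadd_def, vadd_eq_add, add_comm, hper g g.2]

/-- Integrate ψ (x + w) over F × F' in both orders; each inner integral is independent of the
translation. -/
theorem volume_mul_setLIntegral {Λ' : AddSubgroup (EuclideanSpace ℝ (Fin N))} [Countable Λ]
    [Countable Λ'] (hle : Λ ≤ Λ') {F F' : Set (EuclideanSpace ℝ (Fin N))}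
    (hF : IsAddFundamentalDomain Λ F) (hF' : IsAddFundamentalDomain Λ' F')
    {ψ : EuclideanSpace ℝ (Fin N) → ENNReal} (hψ : Measurable ψ)
    (hper : ∀ v ∈ Λ', ∀ x, ψ (x + v) = ψ x) :
    volume F * ∫⁻ x in F', ψ x = volume F' * ∫⁻ x in F, ψ x := by
  have h1 : ∫⁻ x in F, ∫⁻ w in F', ψ (w + x) = (∫⁻ x in F', ψ x) * volume F := by
    simp_rw [setLIntegral_add_right hF' hper]
    rw [setLIntegral_const]
  have h2 : ∫⁻ w in F', ∫⁻ x in F, ψ (x + w) = (∫⁻ x in F, ψ x) * volume F' := by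
    simp_rw [setLIntegral_add_right hF fun v hv => hper v (hle hv)]
    rw [setLIntegral_const]
  rw [mul_comm, ← h1, mul_comm, ← h2, lintegral_lintegral_swap (by fun_prop)]
  simp_rw [add_comm]

theorem lintegral_gauss_mul_eq (hη : 0 < η) {F : Set (EuclideanSpace ℝ (Fin N))}
    (hF : IsAddFundamentalDomain (scaledEmb N η).range F) (s : ℝ)
    {ψ : EuclideanSpace ℝ (Fin N) → ENNReal} (hψ : Measurable ψ)
    (hper : ∀ v ∈ (scaledEmb N η).range, ∀ x, ψ (x + v) = ψ x) :
    ∫⁻ x, ENNReal.ofReal (gauss s x) * ψ x =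
      ∫⁻ x in F, (∑' z : Fin N → ℤ, ENNReal.ofReal (gauss s (x + scaledEmb N η z))) * ψ x := by
  have : Countable (scaledEmb N η).range := countable_of_le_range le_rfl
  rw [hF.lintegral_eq_tsum'', ← (AddMonoidHom.ofInjective
    (scaledEmb_injective (N := N) hη)).toEquiv.tsum_eq]
  simp_rw [← ENNReal.tsum_mul_right]
  rw [lintegral_tsum fun z => by fun_prop]
  refine tsum_congr fun z => lintegral_congr fun x => ?_
  have h : (AddMonoidHom.ofInjective (scaledEmb_injective (N := N) hη)).toEquiv z +ᵥ x =
      x + scaledEmb N η z := by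
    rw [AddSubgroup.vadd_def, vadd_eq_add, add_comm]
    rfl
  rw [h, hper _ ⟨z, rfl⟩]

/-- A Gaussian with flat periodization is nearly uniform modulo `η ℤ ^ N`. -/
theorem lintegral_gauss_mul_volume_le (hη : 0 < η) (hΛ : Λ ≤ (scaledEmb N η).range)
    {F : Set (EuclideanSpace ℝ (Fin N))} (hF : IsAddFundamentalDomain Λ F) {s d : ℝ} (hs : 0 < s)
    (hd : d < 1) (hflat : IsFlat η d s)
    {ψ : EuclideanSpace ℝ (Fin N) → ENNReal} (hψ : Measurable ψ)
    (hper : ∀ v ∈ (scaledEmb N η).range, ∀ x, ψ (x + v) = ψ x) :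
    (∫⁻ x, ENNReal.ofReal (gauss s x) * ψ x) * volume F ≤
      ENNReal.ofReal (((1 + d) / (1 - d)) ^ N) * ∫⁻ x in F, ψ x := by
  have : Countable (scaledEmb N η).range := countable_of_le_range le_rfl
  have : Countable Λ := countable_of_le_range hΛ
  set F' := voronoiCell (scaledEmb N η).range
  have hF' : IsAddFundamentalDomain (scaledEmb N η).range F' :=
    isAddFundamentalDomain_voronoiCell hη le_rfl
  have htop : volume F' ≠ ⊤ := volume_voronoiCell_ne_top hη fun z => ⟨z, rfl⟩
  have hne : volume F' ≠ 0 := hF'.measure_ne_zero (NeZero.ne _)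
  have hd' : 0 < 1 - d := by linarith
  have hd0 : 0 ≤ d := (abs_nonneg _).trans (hflat 0)
  have h1 : ∫⁻ x, ENNReal.ofReal (gauss s x) * ψ x ≤
      ENNReal.ofReal (((1 + d) / η) ^ N) * ∫⁻ x in F', ψ x := by
    rw [lintegral_gauss_mul_eq hη hF' s hψ hper, ← lintegral_const_mul _ hψ]
    exact lintegral_mono fun x => mul_le_mul_left (hflat.tsum_gauss_le hη hs x) _
  -- The case ψ = 1 serves as normalization, so the volume of F' need not be computed.
  have h2 : ENNReal.ofReal (((1 - d) / η) ^ N) * volume F' ≤ 1 := by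
    have := lintegral_gauss_mul_eq hη hF' s (ψ := fun _ => 1) measurable_const fun _ _ _ => rfl
    simp only [mul_one, lintegral_gauss hs] at this
    rw [this, ← setLIntegral_const]
    exact lintegral_mono fun x => hflat.le_tsum_gauss hη hs hd x
  have h3 : ENNReal.ofReal (((1 + d) / η) ^ N) =
      ENNReal.ofReal (((1 + d) / (1 - d)) ^ N) * ENNReal.ofReal (((1 - d) / η) ^ N) := by
    rw [← ENNReal.ofReal_mul (by positivity), ← mul_pow]
    congr 2
    field_simp
  refine (ENNReal.mul_le_mul_iff_left hne htop).1 ?_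
  calc (∫⁻ x, ENNReal.ofReal (gauss s x) * ψ x) * volume F * volume F'
      ≤ ENNReal.ofReal (((1 + d) / η) ^ N) * (∫⁻ x in F', ψ x) * volume F * volume F' := by gcongr
    _ = ENNReal.ofReal (((1 + d) / (1 - d)) ^ N) *
          (ENNReal.ofReal (((1 - d) / η) ^ N) * volume F') * (volume F * ∫⁻ x in F', ψ x) := by
        rw [h3]; ring
    _ ≤ ENNReal.ofReal (((1 + d) / (1 - d)) ^ N) * 1 * (volume F' * ∫⁻ x in F, ψ x) := by
        rw [volume_mul_setLIntegral hΛ hF hF' hψ hper]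
        gcongr
    _ = _ := by ring

end Voronoi

/-! ### Bits that are almost uniform given their past -/

/-- Cost of flipping a bit with weights a, b for a test function with values h, k in [0, 1]. -/
theorem ofReal_mul_add_swap_le {a b : ℝ} (ha : 0 ≤ a) (hb : 0 ≤ b) {h k : ENNReal} (hh : h ≤ 1)
    (hk : k ≤ 1) :
    ENNReal.ofReal a * h + ENNReal.ofReal b * k ≤
      ENNReal.ofReal a * k + ENNReal.ofReal b * h + ENNReal.ofReal |a - b| := by
  rcases le_total b a with hab | hab
  · have h1 : ENNReal.ofReal a = ENNReal.ofReal b + ENNReal.ofReal |a - b| := by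
      rw [← ENNReal.ofReal_add hb (abs_nonneg _), abs_of_nonneg (by linarith)]
      congr 1
      ring
    calc ENNReal.ofReal a * h + ENNReal.ofReal b * k
        = ENNReal.ofReal b * k + ENNReal.ofReal b * h + ENNReal.ofReal |a - b| * h := by
          rw [h1]; ring
      _ ≤ ENNReal.ofReal a * k + ENNReal.ofReal b * h + ENNReal.ofReal |a - b| * 1 := by
          gcongr
      _ = _ := by rw [mul_one]
  · have h1 : ENNReal.ofReal b = ENNReal.ofReal a + ENNReal.ofReal |a - b| := by
      rw [← ENNReal.ofReal_add ha (abs_nonneg _), abs_of_nonpos (by linarith)]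
      congr 1
      ring
    calc ENNReal.ofReal a * h + ENNReal.ofReal b * k
        = ENNReal.ofReal a * k + ENNReal.ofReal a * h + ENNReal.ofReal |a - b| * k := by
          rw [h1]; ring
      _ ≤ ENNReal.ofReal a * k + ENNReal.ofReal b * h + ENNReal.ofReal |a - b| * 1 := by
          gcongr
      _ = _ := by rw [mul_one]

/-- Factor a - b as (√a - √b) (√a + √b) and apply the weighted inequality of arithmetic and
geometric means. After integration this plays the part of Cauchy–Schwarz. -/
theorem abs_sub_le_of_sqrt {a b t : ℝ} (ha : 0 ≤ a) (hb : 0 ≤ b) (ht : 0 < t) :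
    |a - b| ≤ (2 * t)⁻¹ * (a + b - 2 * √(a * b)) + t * (a + b) := by
  obtain ⟨x, hx, rfl⟩ : ∃ x, 0 ≤ x ∧ a = x ^ 2 := ⟨√a, Real.sqrt_nonneg _, (Real.sq_sqrt ha).symm⟩
  obtain ⟨y, hy, rfl⟩ : ∃ y, 0 ≤ y ∧ b = y ^ 2 := ⟨√b, Real.sqrt_nonneg _, (Real.sq_sqrt hb).symm⟩
  rw [← mul_pow, Real.sqrt_sq (by positivity)]
  have h1 : |x ^ 2 - y ^ 2| = |x - y| * (x + y) := by
    rw [show x ^ 2 - y ^ 2 = (x - y) * (x + y) by ring, abs_mul, abs_of_nonneg (add_nonneg hx hy)]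
  have h2 : (2 * t)⁻¹ * (x ^ 2 + y ^ 2 - 2 * (x * y)) + t * (x ^ 2 + y ^ 2) - |x - y| * (x + y) =
      (2 * t)⁻¹ * (|x - y| - t * (x + y)) ^ 2 + t / 2 * (x - y) ^ 2 := by
    field_simp
    linear_combination -sq_abs (x - y)
  rw [h1]
  have : 0 ≤ (2 * t)⁻¹ * (|x - y| - t * (x + y)) ^ 2 + t / 2 * (x - y) ^ 2 := by positivity
  linarith

theorem summable_jointDensity {N : ℕ} {η vr Δ : ℝ} (hη : 0 < η) (hr : 0 < vr) (hΔ : 0 < Δ)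
    (y : Fin N → ℝ) : Summable fun x : Fin N → ℤ => jointDensity η vr Δ x y := by
  have h : Summable fun x : Fin N → ℤ => gauss (vr * Δ / (vr + Δ))
      (scaledEmb N η x - (vr / (vr + Δ)) • (WithLp.toLp 2 y : EuclideanSpace ℝ (Fin N))) := by
    have h1 := tsum_gauss_eq (N := N) hη (show 0 < vr * Δ / (vr + Δ) by positivity)
      (-((vr / (vr + Δ)) • (WithLp.toLp 2 y : EuclideanSpace ℝ (Fin N))))
    have h2 := ENNReal.summable_toReal (h1.trans_ne ENNReal.ofReal_ne_top)
    refine h2.congr fun x => ?_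
    rw [ENNReal.toReal_ofReal (gauss_nonneg _ _), neg_add_eq_sub]
  refine ((h.mul_left (gauss (vr + Δ) (WithLp.toLp 2 y : EuclideanSpace ℝ (Fin N)))).mul_left
    ((∑' k : ℤ, gaussDensity 0 vr (η * k))⁻¹ ^ N)).congr fun x => ?_
  rw [← jointDensity_eq hr hΔ]

/-- The bit `U_ℓ^i` of an integer vector together with its past. -/
def bitClass (m ℓ : ℕ) (i : Fin (2 ^ m)) (x : Fin (2 ^ m) → ℤ) : ZMod 2 × Past m ℓ i :=
  (polarBits ℓ x i, fun j => polarBits ℓ x j.1, fun k => levelBits k x)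

theorem bitClass_eq_iff {m ℓ : ℕ} {i : Fin (2 ^ m)} {x : Fin (2 ^ m) → ℤ} {b : ZMod 2}
    {s : Past m ℓ i} : bitClass m ℓ i x = (b, s) ↔ polarBits ℓ x i = b ∧
      (∀ j, polarBits ℓ x j.1 = s.1 j) ∧ ∀ k : Fin ℓ, levelBits k x = s.2 k := by
  simp only [bitClass, Prod.ext_iff, funext_iff]

theorem bitClass_add_row {m ℓ : ℕ} (i : Fin (2 ^ m)) (x : Fin (2 ^ m) → ℤ) :
    bitClass m ℓ i (x + fun t => 2 ^ ℓ * polarMatrixInt m i t) =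
      ((bitClass m ℓ i x).1 + 1, (bitClass m ℓ i x).2) := by
  simp only [bitClass, polarBits_add_row, if_true]
  refine Prod.ext rfl (Prod.ext ?_ ?_)
  · funext j
    simp [j.2.ne]
  · funext k
    exact levelBits_add_row k.2 _ _

theorem sub_mem_of_bitClass_eq {m ℓ : ℕ} {i : Fin (2 ^ m)} {x x' : Fin (2 ^ m) → ℤ}
    (h : bitClass m ℓ i x = bitClass m ℓ i x') :
    x - x' ∈ coordLattice m (fun j => if j ≤ i then ℓ + 1 else ℓ) := by
  have h' := bitClass_eq_iff.1 (h.trans (Prod.mk.eta (p := bitClass m ℓ i x')).symm)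
  refine sub_mem_of_polarBits_eq (fun j hj => ?_) fun k hk => h'.2.2 ⟨k, hk⟩
  rcases hj.lt_or_eq with hj | rfl
  exacts [h'.2.1 ⟨j, hj⟩, h'.1]

section

variable {m ℓ : ℕ} {i : Fin (2 ^ m)} {η vr Δ : ℝ}

theorem bitDensity_nonneg (b : ZMod 2) (s : Past m ℓ i) (y : Fin (2 ^ m) → ℝ) :
    0 ≤ bitDensity m η vr Δ ℓ i b s y :=
  tsum_nonneg fun x => Set.indicator_nonneg (fun x _ => jointDensity_nonneg _ _ _ x y) x

open Classical in
theorem ofReal_bitDensity (hη : 0 < η) (hr : 0 < vr) (hΔ : 0 < Δ) (b : ZMod 2) (s : Past m ℓ i)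
    (y : Fin (2 ^ m) → ℝ) :
    ENNReal.ofReal (bitDensity m η vr Δ ℓ i b s y) =
      ∑' x, if bitClass m ℓ i x = (b, s) then ENNReal.ofReal (jointDensity η vr Δ x y) else 0 := by
  rw [bitDensity, ENNReal.ofReal_tsum_of_nonneg
    (fun x => Set.indicator_nonneg (fun x _ => jointDensity_nonneg _ _ _ x y) x)
    ((summable_jointDensity hη hr hΔ y).indicator _)]
  refine tsum_congr fun x => ?_
  simp only [Set.indicator, Set.mem_ofPred_eq, bitClass_eq_iff]
  split_ifs <;> simp

theorem measurable_bitDensity (hη : 0 < η) (hr : 0 < vr) (hΔ : 0 < Δ) (b : ZMod 2)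
    (s : Past m ℓ i) : Measurable (bitDensity m η vr Δ ℓ i b s) := by
  classical
  have h : (fun y => (ENNReal.ofReal (bitDensity m η vr Δ ℓ i b s y)).toReal) =
      bitDensity m η vr Δ ℓ i b s := by
    funext y
    exact ENNReal.toReal_ofReal (bitDensity_nonneg b s y)
  rw [← h]
  simp_rw [ofReal_bitDensity hη hr hΔ]
  refine (Measurable.tsum fun x => ?_).ennreal_toReal
  split_ifs <;> fun_prop

theorem tsum_jointDensity_mul (hη : 0 < η) (hr : 0 < vr) (hΔ : 0 < Δ) (y : Fin (2 ^ m) → ℝ)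
    (H : ZMod 2 × Past m ℓ i → ENNReal) :
    ∑' x, ENNReal.ofReal (jointDensity η vr Δ x y) * H (bitClass m ℓ i x) =
      ∑ s, (ENNReal.ofReal (bitDensity m η vr Δ ℓ i 0 s y) * H (0, s) +
        ENNReal.ofReal (bitDensity m η vr Δ ℓ i 1 s y) * H (1, s)) := by
  classical
  have h1 : ∀ s : Past m ℓ i, (ENNReal.ofReal (bitDensity m η vr Δ ℓ i 0 s y) * H (0, s) +
      ENNReal.ofReal (bitDensity m η vr Δ ℓ i 1 s y) * H (1, s)) =
      ∑ b : ZMod 2, ENNReal.ofReal (bitDensity m η vr Δ ℓ i b s y) * H (b, s) :=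
    fun s => (Fin.sum_univ_two (fun b : ZMod 2 =>
      ENNReal.ofReal (bitDensity m η vr Δ ℓ i b s y) * H (b, s))).symm
  simp_rw [h1]
  rw [← Fintype.sum_prod_type_right' (f := fun b s =>
    ENNReal.ofReal (bitDensity m η vr Δ ℓ i b s y) * H (b, s))]
  simp_rw [ofReal_bitDensity hη hr hΔ, ← ENNReal.tsum_mul_right]
  rw [← Summable.tsum_finsetSum fun _ _ => ENNReal.summable]
  refine tsum_congr fun x => ?_
  simp [ite_mul]

theorem sum_lintegral_bitDensity (hη : 0 < η) (hr : 0 < vr) (hΔ : 0 < Δ) :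
    ∑ s, ((∫⁻ y, ENNReal.ofReal (bitDensity m η vr Δ ℓ i 0 s y)) +
      ∫⁻ y, ENNReal.ofReal (bitDensity m η vr Δ ℓ i 1 s y)) = 1 := by
  have hm := fun b s => (measurable_bitDensity (m := m) (ℓ := ℓ) (i := i) hη hr hΔ b s).ennreal_ofReal
  rw [← lintegral_jointDensity (N := 2 ^ m) hη hr hΔ]
  simp_rw [← lintegral_add_left (hm 0 _)]
  have hm2 : ∀ s, Measurable fun y => ENNReal.ofReal (bitDensity m η vr Δ ℓ i 0 s y) +
      ENNReal.ofReal (bitDensity m η vr Δ ℓ i 1 s y) := fun s => (hm 0 s).add (hm 1 s)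
  rw [← lintegral_finsetSum _ fun s _ => hm2 s]
  refine lintegral_congr fun y => ?_
  simpa using (tsum_jointDensity_mul (m := m) (ℓ := ℓ) (i := i) hη hr hΔ y fun _ => 1).symm

theorem integrable_bitDensity (hη : 0 < η) (hr : 0 < vr) (hΔ : 0 < Δ) (b : ZMod 2)
    (s : Past m ℓ i) : Integrable (bitDensity m η vr Δ ℓ i b s) := by
  refine ⟨(measurable_bitDensity hη hr hΔ b s).aestronglyMeasurable, ?_⟩
  rw [hasFiniteIntegral_iff_ofReal (ae_of_all _ (bitDensity_nonneg b s))]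
  have h := sum_lintegral_bitDensity (m := m) (ℓ := ℓ) (i := i) hη hr hΔ
  have h1 := (Finset.single_le_sum (fun _ _ => zero_le) (Finset.mem_univ s)).trans h.le
  have h2 : b = 0 ∨ b = 1 := by revert b; decide
  refine lt_of_le_of_lt (le_trans ?_ h1) ENNReal.one_lt_top
  rcases h2 with rfl | rfl
  exacts [le_self_add, le_add_self]

theorem sum_integral_bitDensity (hη : 0 < η) (hr : 0 < vr) (hΔ : 0 < Δ) :
    ∑ s, ∫ y, (bitDensity m η vr Δ ℓ i 0 s y + bitDensity m η vr Δ ℓ i 1 s y) = 1 := by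
  have hi := fun b s => integrable_bitDensity (m := m) (ℓ := ℓ) (i := i) hη hr hΔ b s
  have h0 := fun b s => ae_of_all volume (bitDensity_nonneg (m := m) (ℓ := ℓ) (i := i)
    (η := η) (vr := vr) (Δ := Δ) b s)
  have h := sum_lintegral_bitDensity (m := m) (ℓ := ℓ) (i := i) hη hr hΔ
  simp_rw [← ofReal_integral_eq_lintegral_ofReal (hi _ _) (h0 _ _)] at h
  simp_rw [← ENNReal.ofReal_add (integral_nonneg_of_ae (h0 _ _)) (integral_nonneg_of_ae (h0 _ _)),
    ← integral_add (hi _ _) (hi _ _)] at h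
  rw [← ENNReal.ofReal_sum_of_nonneg fun s _ => integral_nonneg fun y =>
    add_nonneg (bitDensity_nonneg 0 s y) (bitDensity_nonneg 1 s y)] at h
  exact (ENNReal.ofReal_eq_one).1 h

/-- A Bhattacharyya parameter close to `1` bounds the variational distance. -/
theorem lintegral_abs_bitDensity_sub_le (hη : 0 < η) (hr : 0 < vr) (hΔ : 0 < Δ) {t : ℝ} (ht : 0 < t)
    (hZ : 1 - t ^ 2 ≤ bhattacharyya (bitDensity m η vr Δ ℓ i)) :
    ∫⁻ y, ∑ s, ENNReal.ofReal |bitDensity m η vr Δ ℓ i 0 s y - bitDensity m η vr Δ ℓ i 1 s y| ≤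
      ENNReal.ofReal (3 / 2 * t) := by
  have hi := fun b s => integrable_bitDensity (m := m) (ℓ := ℓ) (i := i) hη hr hΔ b s
  have hm := fun b s => measurable_bitDensity (m := m) (ℓ := ℓ) (i := i) hη hr hΔ b s
  have hn := fun b s => bitDensity_nonneg (m := m) (ℓ := ℓ) (i := i) (η := η) (vr := vr) (Δ := Δ) b s
  have hadd : ∀ s, Integrable fun y =>
      bitDensity m η vr Δ ℓ i 0 s y + bitDensity m η vr Δ ℓ i 1 s y :=
    fun s => (hi 0 s).add (hi 1 s)
  have hsub : ∀ s, Integrable fun y =>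
      |bitDensity m η vr Δ ℓ i 0 s y - bitDensity m η vr Δ ℓ i 1 s y| :=
    fun s => ((hi 0 s).sub (hi 1 s)).abs
  have hmsub : ∀ s, Measurable fun y => ENNReal.ofReal
      |bitDensity m η vr Δ ℓ i 0 s y - bitDensity m η vr Δ ℓ i 1 s y| :=
    fun s => ((hm 0 s).sub (hm 1 s)).abs.ennreal_ofReal
  have hsq : ∀ s, Integrable fun y =>
      √(bitDensity m η vr Δ ℓ i 0 s y * bitDensity m η vr Δ ℓ i 1 s y) := by
    intro s
    refine (hadd s).mono' ((hm 0 s).mul (hm 1 s)).sqrt.aestronglyMeasurable (ae_of_all _ fun y => ?_)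
    rw [Real.norm_eq_abs, abs_of_nonneg (Real.sqrt_nonneg _)]
    refine Real.sqrt_le_iff.2 ⟨add_nonneg (hn 0 s y) (hn 1 s y), ?_⟩
    nlinarith [hn 0 s y, hn 1 s y, mul_nonneg (hn 0 s y) (hn 1 s y)]
  have hbound : ∀ s, ∫ y, |bitDensity m η vr Δ ℓ i 0 s y - bitDensity m η vr Δ ℓ i 1 s y| ≤
      (2 * t)⁻¹ * ((∫ y, (bitDensity m η vr Δ ℓ i 0 s y + bitDensity m η vr Δ ℓ i 1 s y)) -
        2 * ∫ y, √(bitDensity m η vr Δ ℓ i 0 s y * bitDensity m η vr Δ ℓ i 1 s y)) +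
      t * ∫ y, (bitDensity m η vr Δ ℓ i 0 s y + bitDensity m η vr Δ ℓ i 1 s y) := by
    intro s
    have h2 : Integrable fun y => bitDensity m η vr Δ ℓ i 0 s y + bitDensity m η vr Δ ℓ i 1 s y -
        2 * √(bitDensity m η vr Δ ℓ i 0 s y * bitDensity m η vr Δ ℓ i 1 s y) :=
      (hadd s).sub ((hsq s).const_mul 2)
    rw [← integral_const_mul 2, ← integral_sub (hadd s) ((hsq s).const_mul 2),
      ← integral_const_mul t, ← integral_const_mul (2 * t)⁻¹,
      ← integral_add (h2.const_mul _) ((hadd s).const_mul t)]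
    exact integral_mono (hsub s) ((h2.const_mul _).add ((hadd s).const_mul t))
      fun y => abs_sub_le_of_sqrt (hn 0 s y) (hn 1 s y) ht
  rw [lintegral_finsetSum _ fun s _ => hmsub s]
  simp_rw [← ofReal_integral_eq_lintegral_ofReal (hsub _)
    (ae_of_all _ fun _ => abs_nonneg _)]
  rw [← ENNReal.ofReal_sum_of_nonneg fun s _ => integral_nonneg fun y => abs_nonneg _]
  refine ENNReal.ofReal_le_ofReal ((Finset.sum_le_sum fun s _ => hbound s).trans ?_)
  rw [Finset.sum_add_distrib, ← Finset.mul_sum, ← Finset.mul_sum, Finset.sum_sub_distrib,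
    ← Finset.mul_sum, sum_integral_bitDensity hη hr hΔ]
  simp only [bhattacharyya] at hZ
  -- Since 1 - Z ≤ t², the two terms contribute t / 2 and t, hence the constant 3 / 2.
  have h3 : (2 * t)⁻¹ * (1 - 2 * ∑ s, ∫ y,
      √(bitDensity m η vr Δ ℓ i 0 s y * bitDensity m η vr Δ ℓ i 1 s y)) ≤ (2 * t)⁻¹ * t ^ 2 :=
    mul_le_mul_of_nonneg_left (by linarith) (by positivity)
  have h4 : (2 * t)⁻¹ * t ^ 2 = t / 2 := by field_simp
  linarith

/-- The translation flips the bit and keeps the past, so both sums pair the same two densities with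
exchanged values of h. -/
theorem tsum_jointDensity_mul_le_shift (hη : 0 < η) (hr : 0 < vr) (hΔ : 0 < Δ)
    (y : Fin (2 ^ m) → ℝ) {h : (Fin (2 ^ m) → ℤ) → ENNReal} (hle : ∀ x, h x ≤ 1)
    (hclass : ∀ x x', bitClass m ℓ i x = bitClass m ℓ i x' → h x = h x') :
    ∑' x, ENNReal.ofReal (jointDensity η vr Δ x y) * h x ≤
      ∑' x, ENNReal.ofReal (jointDensity η vr Δ x y) *
        h (x + fun t => 2 ^ ℓ * polarMatrixInt m i t) +
      ∑ s, ENNReal.ofReal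
        |bitDensity m η vr Δ ℓ i 0 s y - bitDensity m η vr Δ ℓ i 1 s y| := by
  obtain ⟨H, hH1, hHx⟩ : ∃ H : ZMod 2 × Past m ℓ i → ENNReal, (∀ c, H c ≤ 1) ∧
      ∀ x, h x = H (bitClass m ℓ i x) := by
    -- The supremum over a class lets h descend to classes; an empty class would get the value 0.
    refine ⟨fun c => ⨆ (x) (_ : bitClass m ℓ i x = c), h x, fun c => iSup₂_le fun x _ => hle x,
      fun x => le_antisymm (le_iSup₂_of_le x rfl le_rfl) (iSup₂_le fun x' hx' => ?_)⟩
    exact (hclass x' x hx').le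
  have e1 : ∑' x, ENNReal.ofReal (jointDensity η vr Δ x y) * h x =
      ∑' x, ENNReal.ofReal (jointDensity η vr Δ x y) * H (bitClass m ℓ i x) :=
    tsum_congr fun x => by rw [hHx]
  have e2 : ∑' x, ENNReal.ofReal (jointDensity η vr Δ x y) *
        h (x + fun t => 2 ^ ℓ * polarMatrixInt m i t) =
      ∑' x, ENNReal.ofReal (jointDensity η vr Δ x y) *
        (fun c : ZMod 2 × Past m ℓ i => H (c.1 + 1, c.2)) (bitClass m ℓ i x) :=
    tsum_congr fun x => by rw [hHx, bitClass_add_row]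
  rw [e1, e2, tsum_jointDensity_mul hη hr hΔ y H,
    tsum_jointDensity_mul hη hr hΔ y (fun c : ZMod 2 × Past m ℓ i => H (c.1 + 1, c.2)),
    ← Finset.sum_add_distrib]
  refine Finset.sum_le_sum fun s _ => ?_
  have := ofReal_mul_add_swap_le (bitDensity_nonneg (η := η) (vr := vr) (Δ := Δ) 0 s y)
    (bitDensity_nonneg (η := η) (vr := vr) (Δ := Δ) 1 s y) (hH1 (0, s)) (hH1 (1, s))
  have h1 : (0 + 1 : ZMod 2) = 1 := rfl
  have h2 : (1 + 1 : ZMod 2) = 0 := rfl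
  simp only [h1, h2]
  exact this

/-- By `sub_mem_of_bitClass_eq`, the value of ψ at η x - α y depends on x only through its bit and
past; the loss is then the variational distance. -/
theorem testChannel_le_shift (hη : 0 < η) (hr : 0 < vr) (hΔ : 0 < Δ) {t : ℝ} (ht : 0 < t)
    (hZ : 1 - t ^ 2 ≤ bhattacharyya (bitDensity m η vr Δ ℓ i))
    {ψ : EuclideanSpace ℝ (Fin (2 ^ m)) → ENNReal} (hle : ∀ x, ψ x ≤ 1)
    (hper : ∀ z ∈ coordLattice m (fun j => if j ≤ i then ℓ + 1 else ℓ), ∀ x,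
      ψ (x + scaledEmb _ η z) = ψ x) :
    testChannel η vr Δ ψ ≤ testChannel η vr Δ
      (fun x => ψ (x + scaledEmb _ η fun k => 2 ^ ℓ * polarMatrixInt m i k)) +
        ENNReal.ofReal (3 / 2 * t) := by
  have hD : ∀ y : EuclideanSpace ℝ (Fin (2 ^ m)),
      ∑' x, ENNReal.ofReal (jointDensity η vr Δ x y.ofLp) *
        ψ (scaledEmb _ η x - (vr / (vr + Δ)) • y) ≤
      ∑' x, ENNReal.ofReal (jointDensity η vr Δ x y.ofLp) *
        ψ (scaledEmb _ η x - (vr / (vr + Δ)) • y +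
          scaledEmb _ η fun k => 2 ^ ℓ * polarMatrixInt m i k) +
      ∑ s, ENNReal.ofReal
        |bitDensity m η vr Δ ℓ i 0 s y.ofLp - bitDensity m η vr Δ ℓ i 1 s y.ofLp| := by
    intro y
    refine (tsum_jointDensity_mul_le_shift (ℓ := ℓ) (i := i) hη hr hΔ y.ofLp
      (h := fun x => ψ (scaledEmb _ η x - (vr / (vr + Δ)) • y)) (fun x => hle _)
      fun x x' h => ?_).trans_eq ?_
    · rw [← hper _ (sub_mem_of_bitClass_eq h) (scaledEmb _ η x' - _), map_sub]
      congr 1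
      abel
    · congr 1
      refine tsum_congr fun x => ?_
      rw [map_add, add_sub_right_comm]
  have hmeas : Measurable fun y : Fin (2 ^ m) → ℝ => ∑ s, ENNReal.ofReal
      |bitDensity m η vr Δ ℓ i 0 s y - bitDensity m η vr Δ ℓ i 1 s y| :=
    Finset.measurable_fun_sum _ fun s _ => ((measurable_bitDensity hη hr hΔ 0 s).sub
      (measurable_bitDensity hη hr hΔ 1 s)).abs.ennreal_ofReal
  have hmp := PiLp.volume_preserving_ofLp (Fin (2 ^ m))
  have hm2 := hmeas.comp hmp.measurable
  have h1 := lintegral_abs_bitDensity_sub_le hη hr hΔ ht hZ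
  rw [← hmp.lintegral_comp hmeas] at h1
  refine (lintegral_mono hD).trans ?_
  refine (lintegral_add_right _ hm2).le.trans ?_
  exact add_le_add le_rfl h1

end

/-! ### The test channel is almost uniform modulo the lattice -/

theorem testChannel_add {N : ℕ} (η vr Δ : ℝ) {ψ φ : EuclideanSpace ℝ (Fin N) → ENNReal}
    (hψ : Measurable ψ) :
    testChannel η vr Δ (fun x => ψ x + φ x) = testChannel η vr Δ ψ + testChannel η vr Δ φ := by
  simp only [testChannel, mul_add, ENNReal.tsum_add]
  refine lintegral_add_left ?_ _
  exact Measurable.tsum fun x => by fun_prop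

theorem testChannel_const_mul {N : ℕ} (η vr Δ : ℝ) (c : ENNReal)
    {ψ : EuclideanSpace ℝ (Fin N) → ENNReal} (hψ : Measurable ψ) :
    testChannel η vr Δ (fun x => c * ψ x) = c * testChannel η vr Δ ψ := by
  simp only [testChannel, mul_left_comm _ c, ENNReal.tsum_mul_left]
  refine lintegral_const_mul _ ?_
  exact Measurable.tsum fun x => by fun_prop

/-- The average of a function over two translates. -/
def pairAverage {N : ℕ} (g : EuclideanSpace ℝ (Fin N)) (ψ : EuclideanSpace ℝ (Fin N) → ENNReal)
    (x : EuclideanSpace ℝ (Fin N)) : ENNReal := 2⁻¹ * ψ x + 2⁻¹ * ψ (x + g)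

theorem two_inv_mul_add (a : ENNReal) : 2⁻¹ * a + 2⁻¹ * a = a := by
  rw [← add_mul, ENNReal.inv_two_add_inv_two, one_mul]

section

variable {m : ℕ} {η vr Δ : ℝ}

/-- Coordinate i of z is 2 ^ ℓ q. For even q, z is already a period of ψ; for odd q, z - g and z + g
are, and the two terms of the average trade places. -/
theorem pairAverage_periodic {ℓ : ℕ} {i : Fin (2 ^ m)} {a b : Fin (2 ^ m) → ℕ} (hai : a i = ℓ)
    (hbi : b i = ℓ + 1) (hab : ∀ j ≠ i, b j = a j)
    {ψ : EuclideanSpace ℝ (Fin (2 ^ m)) → ENNReal}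
    (hper : ∀ z ∈ coordLattice m b, ∀ x, ψ (x + scaledEmb _ η z) = ψ x) :
    ∀ z ∈ coordLattice m a, ∀ x,
      pairAverage (scaledEmb _ η fun k => 2 ^ ℓ * polarMatrixInt m i k) ψ (x + scaledEmb _ η z) =
        pairAverage (scaledEmb _ η fun k => 2 ^ ℓ * polarMatrixInt m i k) ψ x := by
  intro z hz x
  obtain ⟨g, hg⟩ : ∃ g : Fin (2 ^ m) → ℤ, g = fun k => 2 ^ ℓ * polarMatrixInt m i k := ⟨_, rfl⟩
  rw [← hg]
  have hgc : ∀ j, coord m g j = 2 ^ ℓ * (Pi.single i 1 : Fin (2 ^ m) → ℤ) j := fun j => by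
    rw [hg, coord_mul, coord_row]
  obtain ⟨q, hq⟩ := hz i
  rw [hai] at hq
  rcases Int.even_or_odd' q with ⟨p, rfl | rfl⟩
  · have hzb : z ∈ coordLattice m b := by
      intro j
      rcases eq_or_ne j i with rfl | hj
      · rw [hbi, hq, pow_succ, ← mul_assoc]
        exact dvd_mul_right _ _
      · rw [hab j hj]
        exact hz j
    simp only [pairAverage]
    rw [hper z hzb, add_right_comm, hper z hzb]
  · have h1 : z - g ∈ coordLattice m b := by
      intro j
      rw [map_sub, Pi.sub_apply, hgc]
      rcases eq_or_ne j i with rfl | hj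
      · rw [hbi, hq, Pi.single_eq_same]
        exact ⟨p, by ring⟩
      · rw [hab j hj, Pi.single_eq_of_ne hj, mul_zero, sub_zero]
        exact hz j
    have h2 : z + g ∈ coordLattice m b := by
      intro j
      rw [map_add, Pi.add_apply, hgc]
      rcases eq_or_ne j i with rfl | hj
      · rw [hbi, hq, Pi.single_eq_same]
        exact ⟨p + 1, by ring⟩
      · rw [hab j hj, Pi.single_eq_of_ne hj, mul_zero, add_zero]
        exact hz j
    simp only [pairAverage]
    have e1 : x + scaledEmb _ η z = x + scaledEmb _ η g + scaledEmb _ η (z - g) := by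
      rw [map_sub]; abel
    have e2 : x + scaledEmb _ η z + scaledEmb _ η g = x + scaledEmb _ η (z + g) := by
      rw [map_add]; abel
    rw [e2, e1, hper _ h1, hper _ h2, add_comm]

/-- The exponents of the lattice that is generated after the first `i` indices of level `ℓ` have
been fixed. -/
def stageExponent (e : Fin (2 ^ m) → ℕ) (ℓ i : ℕ) (j : Fin (2 ^ m)) : ℕ :=
  min (e j) (if (j : ℕ) < i then ℓ + 1 else ℓ)

/-- `ψ (X - α Y')` has nearly the same expectation as for an argument that is uniform modulo the
lattice, up to a factor `K ^ 2` and an error `δ` for each fixed bit. -/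
def StageBound (η vr Δ : ℝ) (e : Fin (2 ^ m) → ℕ) (F : Set (EuclideanSpace ℝ (Fin (2 ^ m))))
    (K δ : ENNReal) (ℓ i : ℕ) : Prop :=
  ∀ ψ : EuclideanSpace ℝ (Fin (2 ^ m)) → ENNReal, Measurable ψ → (∀ x, ψ x ≤ 1) →
    (∀ z ∈ coordLattice m (stageExponent e ℓ i), ∀ x, ψ (x + scaledEmb _ η z) = ψ x) →
    testChannel η vr Δ ψ * volume F ≤
      K ^ 2 * (∫⁻ x in F, ψ x) + ((ℓ * 2 ^ m + i : ℕ) : ENNReal) * δ * volume F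

/-- All exponents vanish, so ψ has period η ℤ ^ N. One factor K leads from the test channel to the
Gaussian, the other from the Gaussian to the mean over F. -/
theorem stageBound_zero (hη : 0 < η) (hr : 0 < vr) (hΔ : 0 < Δ) {d : ℝ} (hd : d < 1)
    (h1 : IsFlat η d vr) (h2 : IsFlat η d ((vr / (vr + Δ)) ^ 2 * (vr + Δ)))
    (h3 : IsFlat η d (vr * Δ / (vr + Δ))) (e : Fin (2 ^ m) → ℕ)
    {F : Set (EuclideanSpace ℝ (Fin (2 ^ m)))}
    (hF : IsAddFundamentalDomain ((coordLattice m e).map (scaledEmb (2 ^ m) η)) F) (δ : ENNReal) :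
    StageBound η vr Δ e F (ENNReal.ofReal (((1 + d) / (1 - d)) ^ (2 ^ m))) δ 0 0 := by
  intro ψ hψ _ hper
  have hper' : ∀ v ∈ (scaledEmb (2 ^ m) η).range, ∀ x, ψ (x + v) = ψ x := by
    rintro _ ⟨z, rfl⟩ x
    refine hper z ?_ x
    rw [show stageExponent e 0 0 = 0 from funext fun j => by simp [stageExponent],
      coordLattice_zero]
    trivial
  have hΛ : (coordLattice m e).map (scaledEmb (2 ^ m) η) ≤ (scaledEmb (2 ^ m) η).range := by
    rintro _ ⟨z, _, rfl⟩
    exact ⟨z, rfl⟩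
  have h4 := testChannel_le hη hr hΔ hd h1 h2 hψ
  have h5 := lintegral_gauss_mul_volume_le hη hΛ hF (show 0 < vr * Δ / (vr + Δ) by positivity)
    hd h3 hψ hper'
  refine le_add_right ?_
  calc _ ≤ _ := mul_le_mul_left h4 _
    _ ≤ _ := by
      rw [mul_assoc, sq, mul_assoc]
      exact mul_le_mul_right h5 _

/-- Apply the previous stage to the average of ψ and its translate by 2 ^ ℓ g_i. The mean over F is
unchanged, and the expectation drops by at most the cost of one frozen bit. -/
theorem stageBound_succ (hη : 0 < η) (hr : 0 < vr) (hΔ : 0 < Δ) {t : ℝ} (ht : 0 < t)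
    {e : Fin (2 ^ m) → ℕ} {F : Set (EuclideanSpace ℝ (Fin (2 ^ m)))}
    (hF : IsAddFundamentalDomain ((coordLattice m e).map (scaledEmb (2 ^ m) η)) F)
    {K : ENNReal} {ℓ : ℕ} (i : Fin (2 ^ m))
    (hZ : ℓ < e i → 1 - t ^ 2 ≤ bhattacharyya (bitDensity m η vr Δ ℓ i))
    (h : StageBound η vr Δ e F K (ENNReal.ofReal (3 / 2 * t)) ℓ i) :
    StageBound η vr Δ e F K (ENNReal.ofReal (3 / 2 * t)) ℓ (i + 1) := by
  intro ψ hψ hle hper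
  have hab : ∀ j ≠ i, stageExponent e ℓ (i + 1) j = stageExponent e ℓ i j := by
    intro j hj
    have hj' : (j : ℕ) ≠ i := fun h => hj (Fin.ext h)
    simp only [stageExponent, show (j : ℕ) < i + 1 ↔ (j : ℕ) < i by omega]
  by_cases hi : ℓ < e i
  · obtain ⟨g, hg⟩ : ∃ g : EuclideanSpace ℝ (Fin (2 ^ m)),
        g = scaledEmb _ η fun k => 2 ^ ℓ * polarMatrixInt m i k := ⟨_, rfl⟩
    have hΛ : (coordLattice m e).map (scaledEmb (2 ^ m) η) ≤ (scaledEmb (2 ^ m) η).range := by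
      rintro _ ⟨z, _, rfl⟩
      exact ⟨z, rfl⟩
    have : Countable ((coordLattice m e).map (scaledEmb (2 ^ m) η)) := countable_of_le_range hΛ
    -- The exponents of `testChannel_le_shift` are those of this stage without the cap e, hence give
    -- a smaller lattice of periods.
    have hshift := testChannel_le_shift hη hr hΔ ht (hZ hi) hle fun z hz x => by
      refine hper z (coordLattice_anti (fun j => ?_) hz) x
      refine (min_le_right _ _).trans_eq ?_
      simp only [Fin.le_def, Nat.lt_succ_iff]
    rw [← hg] at hshift
    have hψg : Measurable fun x => ψ (x + g) := hψ.comp (measurable_add_const g)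
    have hmain := h (pairAverage g ψ) (by unfold pairAverage; fun_prop)
      (fun x => by
        refine (add_le_add (mul_le_mul_right (hle x) _) (mul_le_mul_right (hle _) _)).trans_eq ?_
        rw [two_inv_mul_add])
      (hg ▸ pairAverage_periodic (by simp [stageExponent, hi.le])
        (by simpa [stageExponent] using hi) hab hper)
    have havg : ∫⁻ x in F, pairAverage g ψ x = ∫⁻ x in F, ψ x := by
      simp only [pairAverage]
      rw [lintegral_add_left (by fun_prop), lintegral_const_mul _ hψ, lintegral_const_mul _ hψg,
        setLIntegral_add_right hF (ψ := ψ), two_inv_mul_add]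
      rintro _ ⟨z, hz, rfl⟩ x
      exact hper z (coordLattice_anti (fun j => min_le_left _ _) hz) x
    have htc : testChannel η vr Δ ψ ≤
        testChannel η vr Δ (pairAverage g ψ) + ENNReal.ofReal (3 / 2 * t) := by
      have h1 : testChannel η vr Δ (pairAverage g ψ) =
          2⁻¹ * testChannel η vr Δ ψ + 2⁻¹ * testChannel η vr Δ fun x => ψ (x + g) := by
        unfold pairAverage
        rw [testChannel_add _ _ _ (by fun_prop), testChannel_const_mul _ _ _ _ hψ,
          testChannel_const_mul _ _ _ _ hψg]
      calc testChannel η vr Δ ψ = 2⁻¹ * testChannel η vr Δ ψ + 2⁻¹ * testChannel η vr Δ ψ :=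
            (two_inv_mul_add _).symm
        _ ≤ 2⁻¹ * testChannel η vr Δ ψ + 2⁻¹ * (testChannel η vr Δ (fun x => ψ (x + g)) +
              ENNReal.ofReal (3 / 2 * t)) := by gcongr
        _ ≤ _ := by
            rw [h1, mul_add, add_assoc]
            gcongr
            exact mul_le_of_le_one_left' (by simp)
    rw [havg] at hmain
    calc testChannel η vr Δ ψ * volume F
        ≤ (testChannel η vr Δ (pairAverage g ψ) + ENNReal.ofReal (3 / 2 * t)) * volume F := by
          gcongr
      _ ≤ K ^ 2 * (∫⁻ x in F, ψ x) + ((ℓ * 2 ^ m + i : ℕ) : ENNReal) *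
            ENNReal.ofReal (3 / 2 * t) * volume F + ENNReal.ofReal (3 / 2 * t) * volume F := by
          rw [add_mul]
          gcongr
      _ = _ := by
          rw [← add_assoc (ℓ * 2 ^ m), Nat.cast_succ]
          ring
  -- For e i ≤ ℓ the exponent is already capped, so the lattice does not change.
  · have hsame : stageExponent e ℓ (i + 1) = stageExponent e ℓ i := by
      funext j
      rcases eq_or_ne j i with rfl | hj
      · simp only [stageExponent, Nat.lt_succ_self, if_true, lt_irrefl, if_false]
        omega
      · exact hab j hj
    refine (h ψ hψ hle (hsame ▸ hper)).trans ?_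
    gcongr
    omega

theorem stageBound (hη : 0 < η) (hr : 0 < vr) (hΔ : 0 < Δ) {d t : ℝ} (hd : d < 1)
    (h1 : IsFlat η d vr) (h2 : IsFlat η d ((vr / (vr + Δ)) ^ 2 * (vr + Δ)))
    (h3 : IsFlat η d (vr * Δ / (vr + Δ))) (ht : 0 < t) {e : Fin (2 ^ m) → ℕ}
    {F : Set (EuclideanSpace ℝ (Fin (2 ^ m)))}
    (hF : IsAddFundamentalDomain ((coordLattice m e).map (scaledEmb (2 ^ m) η)) F)
    (hZ : ∀ i, ∀ ℓ < e i, 1 - t ^ 2 ≤ bhattacharyya (bitDensity m η vr Δ ℓ i)) (ℓ : ℕ) :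
    StageBound η vr Δ e F (ENNReal.ofReal (((1 + d) / (1 - d)) ^ (2 ^ m)))
      (ENNReal.ofReal (3 / 2 * t)) ℓ 0 := by
  induction ℓ with
  | zero => exact stageBound_zero hη hr hΔ hd h1 h2 h3 e hF _
  | succ ℓ ih =>
    have hin : ∀ i ≤ 2 ^ m, StageBound η vr Δ e F
        (ENNReal.ofReal (((1 + d) / (1 - d)) ^ (2 ^ m))) (ENNReal.ofReal (3 / 2 * t)) ℓ i := by
      intro i
      induction i with
      | zero => exact fun _ => ih
      | succ i ihi =>
        intro hi
        exact stageBound_succ hη hr hΔ ht hF ⟨i, hi⟩ (hZ _ ℓ) (ihi (by omega))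
    intro ψ hψ hle hper
    have hs : stageExponent e (ℓ + 1) 0 = stageExponent e ℓ (2 ^ m) := by
      funext j
      simp [stageExponent]
    have := hin (2 ^ m) le_rfl ψ hψ hle (hs ▸ hper)
    rwa [show ℓ * 2 ^ m + 2 ^ m = (ℓ + 1) * 2 ^ m + 0 by ring] at this

/-- Gaussian noise of variance at least `vr Δ / (vr + Δ)` is almost uniform modulo the lattice. -/
theorem lintegral_gauss_lattice_le (hη : 0 < η) (hr : 0 < vr) (hΔ : 0 < Δ) {d t : ℝ} (hd : d < 1)
    (h1 : IsFlat η d vr) (h2 : IsFlat η d ((vr / (vr + Δ)) ^ 2 * (vr + Δ)))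
    (h3 : IsFlat η d (vr * Δ / (vr + Δ))) (ht : 0 < t) {r : ℕ} {e : Fin (2 ^ m) → ℕ}
    (her : ∀ j, e j ≤ r) {F : Set (EuclideanSpace ℝ (Fin (2 ^ m)))}
    (hF : IsAddFundamentalDomain ((coordLattice m e).map (scaledEmb (2 ^ m) η)) F)
    (hZ : ∀ i, ∀ ℓ < e i, 1 - t ^ 2 ≤ bhattacharyya (bitDensity m η vr Δ ℓ i))
    {s : ℝ} (hs : vr * Δ / (vr + Δ) ≤ s)
    {ψ : EuclideanSpace ℝ (Fin (2 ^ m)) → ENNReal} (hψ : Measurable ψ) (hle : ∀ x, ψ x ≤ 1)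
    (hper : ∀ z ∈ coordLattice m e, ∀ x, ψ (x + scaledEmb _ η z) = ψ x) :
    (∫⁻ x, ENNReal.ofReal (gauss s x) * ψ x) * volume F ≤
      ENNReal.ofReal (((1 + d) / (1 - d)) ^ (2 ^ m)) ^ 3 * (∫⁻ x in F, ψ x) +
        ENNReal.ofReal (((1 + d) / (1 - d)) ^ (2 ^ m)) * ((r * 2 ^ m : ℕ) : ENNReal) *
          ENNReal.ofReal (3 / 2 * t) * volume F := by
  obtain ⟨K, hK⟩ : ∃ K, K = ENNReal.ofReal (((1 + d) / (1 - d)) ^ (2 ^ m)) := ⟨_, rfl⟩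
  have hS := stageBound hη hr hΔ hd h1 h2 h3 ht hF hZ r
  rw [← hK] at hS ⊢
  have hexp : stageExponent e r 0 = e := by
    funext j
    simp [stageExponent, her j]
  have key : ∀ φ : EuclideanSpace ℝ (Fin (2 ^ m)) → ENNReal, Measurable φ → (∀ x, φ x ≤ 1) →
      (∀ z ∈ coordLattice m e, ∀ x, φ (x + scaledEmb _ η z) = φ x) →
      (∫⁻ x, ENNReal.ofReal (gauss (vr * Δ / (vr + Δ)) x) * φ x) * volume F ≤
      K ^ 3 * (∫⁻ x in F, φ x) + K * ((r * 2 ^ m : ℕ) : ENNReal) *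
          ENNReal.ofReal (3 / 2 * t) * volume F := by
    intro φ hφ hφ1 hφp
    have h4 := le_testChannel hη hr hΔ hd h1 h2 hφ
    have h5 := hS φ hφ hφ1 (by rwa [hexp])
    rw [← hK] at h4
    calc _ ≤ K * testChannel η vr Δ φ * volume F := mul_le_mul_left h4 _
      _ ≤ K * (K ^ 2 * (∫⁻ x in F, φ x) + ((r * 2 ^ m + 0 : ℕ) : ENNReal) *
          ENNReal.ofReal (3 / 2 * t) * volume F) := by
          rw [mul_assoc]
          exact mul_le_mul_right h5 _
      _ = _ := by
          rw [add_zero]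
          ring
  rcases hs.lt_or_eq with hs | rfl
  · have hΛ : (coordLattice m e).map (scaledEmb (2 ^ m) η) ≤ (scaledEmb (2 ^ m) η).range := by
      rintro _ ⟨z, _, rfl⟩
      exact ⟨z, rfl⟩
    have : Countable ((coordLattice m e).map (scaledEmb (2 ^ m) η)) := countable_of_le_range hΛ
    -- Split off independent noise of variance s - σ and condition on it: each translate of ψ
    -- satisfies the bound for σ with the same mean over F.
    have hadd := lintegral_gauss_add (show 0 < vr * Δ / (vr + Δ) by positivity) (sub_pos.2 hs) hψ
    rw [add_sub_cancel] at hadd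
    rw [hadd, ← lintegral_mul_const _ (by fun_prop)]
    have hw : ∀ w, ENNReal.ofReal (gauss (s - vr * Δ / (vr + Δ)) w) *
        (∫⁻ x, ENNReal.ofReal (gauss (vr * Δ / (vr + Δ)) x) * ψ (x + w)) * volume F ≤
        ENNReal.ofReal (gauss (s - vr * Δ / (vr + Δ)) w) * (K ^ 3 * (∫⁻ x in F, ψ x) +
          K * ((r * 2 ^ m : ℕ) : ENNReal) * ENNReal.ofReal (3 / 2 * t) * volume F) := by
      intro w
      rw [mul_assoc]
      refine mul_le_mul_right ?_ _
      have h6 := key (fun x => ψ (x + w)) (hψ.comp (measurable_add_const w)) (fun x => hle _)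
        fun z hz x => by rw [add_right_comm, hper z hz]
      rwa [setLIntegral_add_right hF (ψ := ψ)] at h6
      rintro _ ⟨z, hz, rfl⟩ x
      exact hper z hz x
    refine (lintegral_mono hw).trans ?_
    rw [lintegral_mul_const _ (by fun_prop), lintegral_gauss (sub_pos.2 hs), one_mul]
  · exact key ψ hψ hle hper

end

/-! ### Sets far from the origin -/

theorem integrable_gauss {N : ℕ} {s : ℝ} (hs : 0 < s) :
    Integrable (gauss s : EuclideanSpace ℝ (Fin N) → ℝ) := by
  refine ⟨(measurable_gauss s).aestronglyMeasurable, ?_⟩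
  rw [hasFiniteIntegral_iff_ofReal (ae_of_all _ (gauss_nonneg s)), lintegral_gauss hs]
  exact ENNReal.one_lt_top

theorem integral_gauss {N : ℕ} {s : ℝ} (hs : 0 < s) :
    ∫ x : EuclideanSpace ℝ (Fin N), gauss s x = 1 := by
  rw [integral_eq_lintegral_of_nonneg_ae (ae_of_all _ (gauss_nonneg s))
    (measurable_gauss s).aestronglyMeasurable, lintegral_gauss hs, ENNReal.toReal_one]

/-- The `k`-th moment of `exp (c (‖x‖² - N) / (2 √N))` for a standard Gaussian `x` in `ℝ ^ N`, with
`y = k c / √N`. -/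
def expMoment (N : ℕ) (y : ℝ) : ℝ := Real.exp (-(N / 2) * (Real.log (1 - y) + y))

/-- Exponential tilting by ‖x‖² turns a centred Gaussian into one of larger variance when 0 < y; the
factor is the corresponding moment. -/
theorem gauss_mul_exp {N : ℕ} {σ y : ℝ} (hσ : 0 < σ) (hy : y < 1)
    (x : EuclideanSpace ℝ (Fin N)) :
    gauss σ x * Real.exp (y * (‖x‖ ^ 2 / σ - N) / 2) = expMoment N y * gauss (σ / (1 - y)) x := by
  have hy' : 0 < 1 - y := by linarith
  rw [gauss_eq hσ, gauss_eq (div_pos hσ hy'), expMoment]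
  have h1 : (√(2 * Real.pi * (σ / (1 - y))))⁻¹ ^ N =
      (√(2 * Real.pi * σ))⁻¹ ^ N * Real.exp (N / 2 * Real.log (1 - y)) := by
    rw [← mul_div_assoc, Real.sqrt_div (by positivity), inv_div, div_eq_inv_mul, mul_pow]
    congr 1
    rw [Real.sqrt_eq_rpow, ← Real.rpow_mul_natCast hy'.le, Real.rpow_def_of_pos hy']
    congr 1
    ring
  have h2 : Real.exp (-‖x‖ ^ 2 / (2 * σ)) * Real.exp (y * (‖x‖ ^ 2 / σ - N) / 2) =
      Real.exp (-(N / 2) * (Real.log (1 - y) + y)) * Real.exp (N / 2 * Real.log (1 - y)) *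
        Real.exp (-‖x‖ ^ 2 / (2 * (σ / (1 - y)))) := by
    rw [← Real.exp_add, ← Real.exp_add, ← Real.exp_add]
    congr 1
    field_simp
    ring
  rw [h1]
  linear_combination (√(2 * Real.pi * σ))⁻¹ ^ N * h2

/-- Here log (1 - y) + y = -y² / 2 + O(|y|³) with N y² = u², so only the quadratic term survives. -/
theorem tendsto_expMoment (u : ℝ) :
    Tendsto (fun N : ℕ => expMoment N (u / √N)) atTop (nhds (Real.exp (u ^ 2 / 4))) := by
  refine (Real.continuous_exp.tendsto _).comp ?_
  have hs : Tendsto (fun N : ℕ => √(N : ℝ)) atTop atTop :=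
    Real.tendsto_sqrt_atTop.comp tendsto_natCast_atTop_atTop
  have hy : Tendsto (fun N : ℕ => |u / √(N : ℝ)|) atTop (nhds 0) := by
    simpa using (hs.const_div_atTop u).abs
  have hb : Tendsto (fun N : ℕ => u ^ 2 / 2 * (|u / √(N : ℝ)| / (1 - |u / √(N : ℝ)|))) atTop
      (nhds 0) := by
    have := (hy.div (tendsto_const_nhds.sub hy) (by norm_num : (1 : ℝ) - 0 ≠ 0)).const_mul
      (u ^ 2 / 2)
    simpa using this
  rw [tendsto_iff_norm_sub_tendsto_zero]
  refine squeeze_zero' (Eventually.of_forall fun _ => norm_nonneg _) ?_ hb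
  filter_upwards [hy.eventually (gt_mem_nhds one_pos), eventually_gt_atTop 0] with N hN hpos
  have hN0 : (0 : ℝ) < N := by exact_mod_cast hpos
  obtain ⟨y, hy⟩ : ∃ y, y = u / √(N : ℝ) := ⟨_, rfl⟩
  rw [← hy] at hN ⊢
  have hNy : N * y ^ 2 = u ^ 2 := by
    rw [hy, div_pow, Real.sq_sqrt hN0.le]
    field_simp
  have h := Real.abs_log_sub_add_sum_range_le hN 2
  simp only [Finset.sum_range_succ, Finset.sum_range_zero] at h
  have e : -((N : ℝ) / 2) * (Real.log (1 - y) + y) - u ^ 2 / 4 =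
      -(N / 2) * (0 + y ^ (0 + 1) / ((0 : ℕ) + 1) + y ^ (1 + 1) / ((1 : ℕ) + 1) +
        Real.log (1 - y)) := by
    rw [← hNy]
    push_cast
    ring
  rw [e, norm_mul, Real.norm_eq_abs, Real.norm_eq_abs, abs_neg, abs_of_pos (by positivity)]
  refine (mul_le_mul_of_nonneg_left h (by positivity)).trans_eq ?_
  rw [← hNy, ← sq_abs y]
  ring

theorem integral_add_add_add {α : Type*} [MeasurableSpace α] {μ : Measure α} {f g h k : α → ℝ}
    (hf : Integrable f μ) (hg : Integrable g μ) (hh : Integrable h μ) (hk : Integrable k μ) :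
    ∫ x, (f x + g x + h x + k x) ∂μ =
      (∫ x, f x ∂μ) + (∫ x, g x ∂μ) + (∫ x, h x ∂μ) + ∫ x, k x ∂μ := by
  have hfg : Integrable (fun x => f x + g x) μ := hf.add hg
  have hfgh : Integrable (fun x => f x + g x + h x) μ := hfg.add hh
  rw [integral_add hfgh hk, integral_add hfg hh, integral_add hf hg]

/-- If Gaussians of all variances `s ≥ σ` give a set nearly the same probability, then the set is
either small or contains points of norm less than `√((N - 3) σ)`. -/
theorem eventually_prob_le :
    ∀ᶠ N : ℕ in atTop, ∀ (σ : ℝ) (B : Set (EuclideanSpace ℝ (Fin N))) (p ε : ℝ), 0 < σ →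
      MeasurableSet B → (∀ x ∈ B, (N - 3) * σ ≤ ‖x‖ ^ 2) → 0 ≤ p →
      (∀ s, σ ≤ s → |(∫ x in B, gauss s x) - p| ≤ ε) → p ≤ 120 * ε := by
  -- This c makes the limiting moments those of a lognormal variable, (11/10) ^ (k²).
  obtain ⟨c, hc0, hc⟩ : ∃ c : ℝ, 0 < c ∧ Real.exp (c ^ 2 / 4) = 11 / 10 := by
    refine ⟨2 * √(Real.log (11 / 10)), by
      have := Real.log_pos (show (1 : ℝ) < 11 / 10 by norm_num)
      positivity, ?_⟩
    rw [mul_pow, Real.sq_sqrt (Real.log_nonneg (by norm_num))]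
    rw [show (2 : ℝ) ^ 2 * Real.log (11 / 10) / 4 = Real.log (11 / 10) by ring,
      Real.exp_log (by norm_num)]
  have hexp : ∀ k : ℕ, Real.exp ((k * c) ^ 2 / 4) = (11 / 10) ^ (k ^ 2) := by
    intro k
    rw [← hc, ← Real.exp_nat_mul]
    congr 1
    push_cast
    ring
  have hm : ∀ k : ℕ, Tendsto (fun N : ℕ => expMoment N (k * c / √N)) atTop
      (nhds ((11 / 10) ^ (k ^ 2))) := fun k => hexp k ▸ tendsto_expMoment (k * c)
  have hs : Tendsto (fun N : ℕ => √(N : ℝ)) atTop atTop :=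
    Real.tendsto_sqrt_atTop.comp tendsto_natCast_atTop_atTop
  have hX : Tendsto (fun N : ℕ => Real.exp (-(3 * c / 2) / √(N : ℝ))) atTop (nhds 1) := by
    have := (Real.continuous_exp.tendsto 0).comp (hs.const_div_atTop (-(3 * c / 2)))
    simpa [Function.comp_def] using this
  have hy : Tendsto (fun N : ℕ => 3 * c / √(N : ℝ)) atTop (nhds 0) := hs.const_div_atTop _
  -- The mean of -(X - Z) (X - 3)², expanded in the moments of X. Its limit is about 0.39, above 1 /
  -- 3; the absolute coefficients in `hup` sum to about 38.1, below 40. The quotient of 40 by 1 / 3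
  -- is the constant 120.
  have hlow : Tendsto (fun N : ℕ =>
      9 * Real.exp (-(3 * c / 2) / √(N : ℝ)) * expMoment N ((0 : ℕ) * c / √N) -
      (9 + 6 * Real.exp (-(3 * c / 2) / √(N : ℝ))) * expMoment N ((1 : ℕ) * c / √N) +
      (Real.exp (-(3 * c / 2) / √(N : ℝ)) + 6) * expMoment N ((2 : ℕ) * c / √N) -
      expMoment N ((3 : ℕ) * c / √N)) atTop
      (nhds (9 * 1 * (11 / 10) ^ (0 ^ 2) - (9 + 6 * 1) * (11 / 10) ^ (1 ^ 2) +
        (1 + 6) * (11 / 10) ^ (2 ^ 2) - (11 / 10) ^ (3 ^ 2))) :=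
    ((((hX.const_mul 9).mul (hm 0)).sub (((hX.const_mul 6).const_add 9).mul (hm 1))).add
      ((hX.add_const 6).mul (hm 2))).sub (hm 3)
  have hup : Tendsto (fun N : ℕ => 9 * expMoment N ((0 : ℕ) * c / √N) +
      15 * expMoment N ((1 : ℕ) * c / √N) + 7 * expMoment N ((2 : ℕ) * c / √N) +
      expMoment N ((3 : ℕ) * c / √N)) atTop
      (nhds (9 * (11 / 10) ^ (0 ^ 2) + 15 * (11 / 10) ^ (1 ^ 2) + 7 * (11 / 10) ^ (2 ^ 2) +
        (11 / 10) ^ (3 ^ 2))) :=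
    ((((hm 0).const_mul 9).add ((hm 1).const_mul 15)).add ((hm 2).const_mul 7)).add (hm 3)
  filter_upwards [hlow.eventually (lt_mem_nhds (show (1 / 3 : ℝ) < _ by norm_num)),
    hup.eventually (gt_mem_nhds (show _ < (40 : ℝ) by norm_num)),
    hy.eventually (gt_mem_nhds one_pos), eventually_gt_atTop 0] with N h1 h2 h3 hN
  intro σ B p ε hσ hB hBn hp hε
  have hN0 : (0 : ℝ) < √(N : ℝ) := Real.sqrt_pos.2 (by exact_mod_cast hN)
  obtain ⟨Z, hZ⟩ : ∃ Z, Z = Real.exp (-(3 * c / 2) / √(N : ℝ)) := ⟨_, rfl⟩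
  rw [← hZ] at h1
  have hZ0 : 0 < Z := hZ ▸ Real.exp_pos _
  have hZ1 : Z ≤ 1 := by
    rw [hZ, Real.exp_le_one_iff, neg_div, neg_nonpos]
    positivity
  have hyk : ∀ k : ℕ, k ≤ 3 → 0 ≤ k * c / √(N : ℝ) ∧ k * c / √(N : ℝ) < 1 := by
    intro k hk
    have hk' : (k : ℝ) ≤ 3 := by exact_mod_cast hk
    refine ⟨by positivity, lt_of_le_of_lt ?_ h3⟩
    gcongr
  have hG : ∀ k : ℕ, k ≤ 3 → |(∫ x in B, gauss (σ / (1 - k * c / √(N : ℝ))) x) - p| ≤ ε := by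
    intro k hk
    obtain ⟨h4, h5⟩ := hyk k hk
    refine hε _ ?_
    rw [le_div_iff₀ (by linarith)]
    nlinarith
  have hint : ∀ k : ℕ, k ≤ 3 → ∀ a : ℝ, Integrable (fun x : EuclideanSpace ℝ (Fin N) =>
      a * expMoment N (k * c / √N) * gauss (σ / (1 - k * c / √(N : ℝ))) x)
      (volume.restrict B) := by
    intro k hk a
    exact ((integrable_gauss (div_pos hσ (by linarith [(hyk k hk).2]))).restrict).const_mul _
  -- After tilting, this is gauss σ x times -(X - Z) (X - 3)², nonpositive because ‖x‖² ≥ (N - 3) σ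
  -- gives X ≥ Z.
  have hpt : ∀ x ∈ B,
      9 * Z * expMoment N ((0 : ℕ) * c / √N) * gauss (σ / (1 - (0 : ℕ) * c / √(N : ℝ))) x +
      -(9 + 6 * Z) * expMoment N ((1 : ℕ) * c / √N) * gauss (σ / (1 - (1 : ℕ) * c / √(N : ℝ))) x +
      (Z + 6) * expMoment N ((2 : ℕ) * c / √N) * gauss (σ / (1 - (2 : ℕ) * c / √(N : ℝ))) x +
      (-1) * expMoment N ((3 : ℕ) * c / √N) * gauss (σ / (1 - (3 : ℕ) * c / √(N : ℝ))) x ≤ 0 := by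
    intro x hx
    simp only [mul_assoc]
    rw [← gauss_mul_exp hσ (hyk 0 (by norm_num)).2, ← gauss_mul_exp hσ (hyk 1 (by norm_num)).2,
      ← gauss_mul_exp hσ (hyk 2 (by norm_num)).2, ← gauss_mul_exp hσ (hyk 3 (by norm_num)).2]
    obtain ⟨X, hXd⟩ : ∃ X, X = Real.exp (c / √(N : ℝ) * (‖x‖ ^ 2 / σ - N) / 2) := ⟨_, rfl⟩
    have hXk : ∀ k : ℕ, Real.exp (k * c / √(N : ℝ) * (‖x‖ ^ 2 / σ - N) / 2) = X ^ k := by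
      intro k
      rw [hXd, ← Real.exp_nat_mul]
      congr 1
      ring
    simp only [hXk]
    have hZX : Z ≤ X := by
      rw [hZ, hXd]
      refine Real.exp_le_exp.2 ?_
      have h4 : (N : ℝ) - 3 ≤ ‖x‖ ^ 2 / σ := (le_div_iff₀ hσ).2 (hBn x hx)
      have h5 : c / √(N : ℝ) * (-3) ≤ c / √(N : ℝ) * (‖x‖ ^ 2 / σ - N) :=
        mul_le_mul_of_nonneg_left (by linarith) (by positivity)
      have h6 : -(3 * c / 2) / √(N : ℝ) = c / √(N : ℝ) * (-3) / 2 := by ring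
      linarith
    have h7 : 0 ≤ gauss σ x * ((X - Z) * (X - 3) ^ 2) :=
      mul_nonneg (gauss_nonneg _ _) (mul_nonneg (by linarith) (sq_nonneg _))
    nlinarith
  have hI := integral_nonpos_of_ae (μ := volume.restrict B)
    ((ae_restrict_iff' hB).2 (ae_of_all _ hpt))
  replace hI := (integral_add_add_add (hint 0 (by norm_num) (9 * Z))
    (hint 1 (by norm_num) (-(9 + 6 * Z))) (hint 2 (by norm_num) (Z + 6))
    (hint 3 (by norm_num) (-1))).symm.trans_le hI
  simp only [integral_const_mul] at hI
  have hmp : ∀ y, 0 < expMoment N y := fun y => Real.exp_pos _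
  have g0 := abs_le.1 (hG 0 (by norm_num))
  have g1 := abs_le.1 (hG 1 (by norm_num))
  have g2 := abs_le.1 (hG 2 (by norm_num))
  have g3 := abs_le.1 (hG 3 (by norm_num))
  generalize (∫ x in B, gauss (σ / (1 - (0 : ℕ) * c / √(N : ℝ))) x) = G0 at *
  generalize (∫ x in B, gauss (σ / (1 - (1 : ℕ) * c / √(N : ℝ))) x) = G1 at *
  generalize (∫ x in B, gauss (σ / (1 - (2 : ℕ) * c / √(N : ℝ))) x) = G2 at *
  generalize (∫ x in B, gauss (σ / (1 - (3 : ℕ) * c / √(N : ℝ))) x) = G3 at *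
  have m0 := hmp ((0 : ℕ) * c / √N)
  have m1 := hmp ((1 : ℕ) * c / √N)
  have m2 := hmp ((2 : ℕ) * c / √N)
  have m3 := hmp ((3 : ℕ) * c / √N)
  generalize expMoment N ((0 : ℕ) * c / √N) = M0 at *
  generalize expMoment N ((1 : ℕ) * c / √N) = M1 at *
  generalize expMoment N ((2 : ℕ) * c / √N) = M2 at *
  generalize expMoment N ((3 : ℕ) * c / √N) = M3 at *
  have hε0 : 0 ≤ ε := by linarith [g0.1, g0.2]
  have b0 : 9 * Z * M0 * (p - ε) ≤ 9 * Z * M0 * G0 :=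
    mul_le_mul_of_nonneg_left (by linarith [g0.1]) (by positivity)
  have b1 : (9 + 6 * Z) * M1 * G1 ≤ (9 + 6 * Z) * M1 * (p + ε) :=
    mul_le_mul_of_nonneg_left (by linarith [g1.2]) (by positivity)
  have b2 : (Z + 6) * M2 * (p - ε) ≤ (Z + 6) * M2 * G2 :=
    mul_le_mul_of_nonneg_left (by linarith [g2.1]) (by positivity)
  have b3 : M3 * G3 ≤ M3 * (p + ε) :=
    mul_le_mul_of_nonneg_left (by linarith [g3.2]) m3.le
  have k0 : 9 * Z * M0 * ε ≤ 9 * M0 * ε := by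
    have : Z * (M0 * ε) ≤ 1 * (M0 * ε) := mul_le_mul_of_nonneg_right hZ1 (by positivity)
    nlinarith
  have k1 : (9 + 6 * Z) * M1 * ε ≤ 15 * M1 * ε := by
    have : Z * (M1 * ε) ≤ 1 * (M1 * ε) := mul_le_mul_of_nonneg_right hZ1 (by positivity)
    nlinarith
  have k2 : (Z + 6) * M2 * ε ≤ 7 * M2 * ε := by
    have : Z * (M2 * ε) ≤ 1 * (M2 * ε) := mul_le_mul_of_nonneg_right hZ1 (by positivity)
    nlinarith
  have hfin : p * (9 * Z * M0 - (9 + 6 * Z) * M1 + (Z + 6) * M2 - M3) ≤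
      (9 * M0 + 15 * M1 + 7 * M2 + M3) * ε := by
    nlinarith
  have e1 : p * (1 / 3) ≤ p * (9 * Z * M0 - (9 + 6 * Z) * M1 + (Z + 6) * M2 - M3) :=
    mul_le_mul_of_nonneg_left h1.le hp
  have e2 : (9 * M0 + 15 * M1 + 7 * M2 + M3) * ε ≤ 40 * ε :=
    mul_le_mul_of_nonneg_right h2.le hε0
  linarith

/-! ### The second moment -/

section

variable {m : ℕ} {η vr Δ : ℝ}

theorem integral_gauss_lattice_le (hη : 0 < η) (hr : 0 < vr) (hΔ : 0 < Δ) {d t : ℝ} (hd : d < 1)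
    (h1 : IsFlat η d vr) (h2 : IsFlat η d ((vr / (vr + Δ)) ^ 2 * (vr + Δ)))
    (h3 : IsFlat η d (vr * Δ / (vr + Δ))) (ht : 0 < t) {r : ℕ} {e : Fin (2 ^ m) → ℕ}
    (her : ∀ j, e j ≤ r) {F : Set (EuclideanSpace ℝ (Fin (2 ^ m)))} (hV : volume F ≠ ⊤)
    (hF : IsAddFundamentalDomain ((coordLattice m e).map (scaledEmb (2 ^ m) η)) F)
    (hZ : ∀ i, ∀ ℓ < e i, 1 - t ^ 2 ≤ bhattacharyya (bitDensity m η vr Δ ℓ i))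
    {s : ℝ} (hs : vr * Δ / (vr + Δ) ≤ s) {B : Set (EuclideanSpace ℝ (Fin (2 ^ m)))}
    (hB : MeasurableSet B)
    (hper : ∀ z ∈ coordLattice m e, ∀ x, x + scaledEmb _ η z ∈ B ↔ x ∈ B) :
    ∫ x in B, gauss s x ≤
      (((1 + d) / (1 - d)) ^ (2 ^ m)) ^ 3 * (volume.real (B ∩ F) / volume.real F) +
        ((1 + d) / (1 - d)) ^ (2 ^ m) * ((r * 2 ^ m : ℕ) * (3 / 2 * t)) := by
  have hs0 : 0 < s := lt_of_lt_of_le (by positivity) hs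
  have hd0 : 0 ≤ d := (abs_nonneg _).trans (h1 0)
  have hd' : 0 < 1 - d := by linarith
  have hΛ : (coordLattice m e).map (scaledEmb (2 ^ m) η) ≤ (scaledEmb (2 ^ m) η).range := by
    rintro _ ⟨z, _, rfl⟩
    exact ⟨z, rfl⟩
  have : Countable ((coordLattice m e).map (scaledEmb (2 ^ m) η)) := countable_of_le_range hΛ
  have hV0 : 0 < volume.real F := ENNReal.toReal_pos (hF.measure_ne_zero (NeZero.ne _)) hV
  obtain ⟨K, hK⟩ : ∃ K, K = ((1 + d) / (1 - d)) ^ (2 ^ m) := ⟨_, rfl⟩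
  have hK0 : 0 ≤ K := hK ▸ by positivity
  have h := lintegral_gauss_lattice_le hη hr hΔ hd h1 h2 h3 ht her hF hZ hs
    (ψ := B.indicator 1) (measurable_one.indicator hB)
    (fun x => Set.indicator_le_self' (fun _ _ => zero_le_one) x) fun z hz x => by
      by_cases hx : x ∈ B
      · rw [Set.indicator_of_mem hx, Set.indicator_of_mem ((hper z hz x).2 hx)]
        rfl
      · rw [Set.indicator_of_notMem hx, Set.indicator_of_notMem fun h => hx ((hper z hz x).1 h)]
  rw [← hK] at h ⊢
  have e1 : ∫⁻ x, ENNReal.ofReal (gauss s x) * B.indicator 1 x =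
      ENNReal.ofReal (∫ x in B, gauss s x) := by
    rw [ofReal_integral_eq_lintegral_ofReal (integrable_gauss hs0).restrict
      (ae_of_all _ (gauss_nonneg s)), ← lintegral_indicator hB]
    refine lintegral_congr fun x => ?_
    by_cases hx : x ∈ B <;> simp [hx]
  have e2 : ∫⁻ x in F, B.indicator 1 x = volume (B ∩ F) := by
    rw [lintegral_indicator_one hB, Measure.restrict_apply hB]
  rw [e1, e2] at h
  have hBF : volume (B ∩ F) ≠ ⊤ := measure_ne_top_of_subset Set.inter_subset_right hV
  have h4 := ENNReal.toReal_mono (by finiteness) h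
  rw [ENNReal.toReal_add (by finiteness) (by finiteness)] at h4
  simp only [ENNReal.toReal_mul, ENNReal.toReal_pow, ENNReal.toReal_ofReal hK0,
    ENNReal.toReal_natCast, ENNReal.toReal_ofReal (show 0 ≤ 3 / 2 * t by positivity),
    ENNReal.toReal_ofReal (integral_nonneg (gauss_nonneg s))] at h4
  have e3 : K ^ 3 * (volume.real (B ∩ F) / volume.real F) + K * ((r * 2 ^ m : ℕ) * (3 / 2 * t)) =
      (K ^ 3 * volume.real (B ∩ F) + K * (r * 2 ^ m : ℕ) * (3 / 2 * t) * volume.real F) /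
        volume.real F := by
    field_simp
  rw [e3, le_div_iff₀ hV0]
  exact h4

/-- The upper bound applies to B and to its complement; since both pairs of probabilities sum to 1,
it is two-sided. -/
theorem abs_integral_gauss_lattice_sub_le (hη : 0 < η) (hr : 0 < vr) (hΔ : 0 < Δ) {d t : ℝ}
    (hd : d < 1) (h1 : IsFlat η d vr) (h2 : IsFlat η d ((vr / (vr + Δ)) ^ 2 * (vr + Δ)))
    (h3 : IsFlat η d (vr * Δ / (vr + Δ))) (ht : 0 < t) {r : ℕ} {e : Fin (2 ^ m) → ℕ}
    (her : ∀ j, e j ≤ r) {F : Set (EuclideanSpace ℝ (Fin (2 ^ m)))} (hV : volume F ≠ ⊤)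
    (hF : IsAddFundamentalDomain ((coordLattice m e).map (scaledEmb (2 ^ m) η)) F)
    (hZ : ∀ i, ∀ ℓ < e i, 1 - t ^ 2 ≤ bhattacharyya (bitDensity m η vr Δ ℓ i))
    {s : ℝ} (hs : vr * Δ / (vr + Δ) ≤ s) {B : Set (EuclideanSpace ℝ (Fin (2 ^ m)))}
    (hB : MeasurableSet B)
    (hper : ∀ z ∈ coordLattice m e, ∀ x, x + scaledEmb _ η z ∈ B ↔ x ∈ B) :
    |(∫ x in B, gauss s x) - volume.real (B ∩ F) / volume.real F| ≤
      (((1 + d) / (1 - d)) ^ (2 ^ m)) ^ 3 - 1 +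
        ((1 + d) / (1 - d)) ^ (2 ^ m) * ((r * 2 ^ m : ℕ) * (3 / 2 * t)) := by
  have hs0 : 0 < s := lt_of_lt_of_le (by positivity) hs
  have hd0 : 0 ≤ d := (abs_nonneg _).trans (h1 0)
  have hΛ : (coordLattice m e).map (scaledEmb (2 ^ m) η) ≤ (scaledEmb (2 ^ m) η).range := by
    rintro _ ⟨z, _, rfl⟩
    exact ⟨z, rfl⟩
  have : Countable ((coordLattice m e).map (scaledEmb (2 ^ m) η)) := countable_of_le_range hΛ
  have hV0 : 0 < volume.real F := ENNReal.toReal_pos (hF.measure_ne_zero (NeZero.ne _)) hV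
  have hK1 : 1 ≤ (((1 + d) / (1 - d)) ^ (2 ^ m)) ^ 3 := by
    refine one_le_pow₀ (one_le_pow₀ ?_)
    rw [le_div_iff₀ (by linarith)]
    linarith
  have hb := integral_gauss_lattice_le hη hr hΔ hd h1 h2 h3 ht her hV hF hZ hs hB hper
  have hbc := integral_gauss_lattice_le hη hr hΔ hd h1 h2 h3 ht her hV hF hZ hs hB.compl
    fun z hz x => not_congr (hper z hz x)
  have hsum := integral_add_compl hB (integrable_gauss (N := 2 ^ m) hs0)
  rw [integral_gauss hs0] at hsum
  have hvol : volume.real (B ∩ F) / volume.real F + volume.real (Bᶜ ∩ F) / volume.real F = 1 := by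
    rw [← add_div, div_eq_one_iff_eq hV0.ne', Set.inter_comm B, Set.inter_comm Bᶜ,
      ← Set.sdiff_eq]
    exact measureReal_inter_add_sdiff₀ hB.nullMeasurableSet hV
  have hp0 : 0 ≤ volume.real (B ∩ F) / volume.real F := by positivity
  have hp0' : 0 ≤ volume.real (Bᶜ ∩ F) / volume.real F := by positivity
  generalize volume.real (B ∩ F) / volume.real F = p at *
  generalize volume.real (Bᶜ ∩ F) / volume.real F = p' at *
  generalize (((1 + d) / (1 - d)) ^ (2 ^ m)) ^ 3 = K at *
  rw [abs_le]
  constructor <;> nlinarith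

end

/-- A point of the cell is at least as close to 0 as to any lattice point, so outside the far set
its squared norm is below R; on the far set the crude bound M is used. -/
theorem secondMoment_le {N : ℕ} {η : ℝ} (hη : 0 < η) (hN : 0 < N)
    {Λ : AddSubgroup (EuclideanSpace ℝ (Fin N))} (hΛ : Λ ≤ (scaledEmb N η).range)
    (hV : volume (voronoiCell Λ) ≠ ⊤) {R M : ℝ} (hR : 0 ≤ R)
    (hM : ∀ u ∈ voronoiCell Λ, ‖u‖ ^ 2 ≤ M) :
    secondMoment Λ ≤ (R + M * (volume.real ({u | ∀ v ∈ Λ, R ≤ ‖u - v‖ ^ 2} ∩ voronoiCell Λ) /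
      volume.real (voronoiCell Λ))) / N := by
  have : Countable Λ := countable_of_le_range hΛ
  have hF := isAddFundamentalDomain_voronoiCell hη hΛ
  have hV0 : 0 < volume.real (voronoiCell Λ) :=
    ENNReal.toReal_pos (hF.measure_ne_zero (NeZero.ne _)) hV
  obtain ⟨B, hBd⟩ : ∃ B, B = {u | ∀ v ∈ Λ, R ≤ ‖u - v‖ ^ 2} := ⟨_, rfl⟩
  have hB : MeasurableSet B := by
    rw [hBd]
    simp only [Set.ofPred_forall]
    exact (isClosed_biInter fun v _ => isClosed_le (by fun_prop) (by fun_prop)).measurableSet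
  rw [← hBd]
  have hfin : IsFiniteMeasure (volume.restrict (voronoiCell Λ)) := ⟨by
    rw [Measure.restrict_apply_univ]
    exact hV.lt_top⟩
  have hmain : ∫ u in voronoiCell Λ, ‖u‖ ^ 2 ≤
      R * volume.real (voronoiCell Λ) + M * volume.real (B ∩ voronoiCell Λ) := by
    have hi : Integrable (fun u => R + B.indicator (fun _ => M) u)
        (volume.restrict (voronoiCell Λ)) :=
      (integrable_const R).add ((integrable_const M).indicator hB)
    refine (integral_mono_of_nonneg (ae_of_all _ fun u => sq_nonneg _) hi
      ((ae_restrict_iff' isClosed_voronoiCell.measurableSet).2 (ae_of_all _ fun u hu => ?_))).trans_eq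
      ?_
    · by_cases hb : u ∈ B
      · simp only [Set.indicator_of_mem hb]
        linarith [hM u hu]
      · simp only [Set.indicator_of_notMem hb, add_zero]
        rw [hBd, Set.mem_ofPred_eq] at hb
        push Not at hb
        obtain ⟨v, hv, hlt⟩ := hb
        exact (pow_le_pow_left₀ (norm_nonneg _) (hu v hv) 2).trans hlt.le
    · rw [integral_add (integrable_const R) ((integrable_const M).indicator hB),
        integral_indicator hB, Measure.restrict_restrict hB]
      simp [mul_comm]
  have hN' : (0 : ℝ) < N := by exact_mod_cast hN
  rw [secondMoment, div_le_div_iff₀ (by positivity) hN']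
  have e : (R + M * (volume.real (B ∩ voronoiCell Λ) / volume.real (voronoiCell Λ))) *
      (N * volume.real (voronoiCell Λ)) =
      (R * volume.real (voronoiCell Λ) + M * volume.real (B ∩ voronoiCell Λ)) * N := by
    field_simp
  rw [e]
  exact mul_le_mul_of_nonneg_right hmain hN'.le

/-! ### Asymptotic estimates -/

theorem tendsto_pow_mul_exp_neg_mul (n : ℕ) {κ : ℝ} (hκ : 0 < κ) :
    Tendsto (fun x : ℝ => x ^ n * Real.exp (-κ * x)) atTop (nhds 0) := by
  simpa using tendsto_rpow_mul_exp_neg_mul_atTop_nhds_zero n κ hκ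

theorem tendsto_pow_mul_two_rpow (n : ℕ) {β : ℝ} (hβ : 0 < β) :
    Tendsto (fun x : ℝ => x ^ n * (2 : ℝ) ^ (-x ^ β / 2)) atTop (nhds 0) := by
  have h := (tendsto_rpow_mul_exp_neg_mul_atTop_nhds_zero (n / β) (Real.log 2 / 2)
    (by have := Real.log_pos one_lt_two; positivity)).comp (tendsto_rpow_atTop hβ)
  refine h.congr' ?_
  filter_upwards [eventually_gt_atTop 0] with x hx
  simp only [Function.comp_apply]
  rw [← Real.rpow_mul hx.le, mul_div_cancel₀ _ hβ.ne', Real.rpow_natCast,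
    Real.rpow_def_of_pos two_pos]
  congr 2
  ring

theorem IsFlat.mono {η d d' v : ℝ} (h : IsFlat η d v) (hd : d ≤ d') : IsFlat η d' v :=
  fun w => (h w).trans hd

theorem isFlat_of_le {η v κ x : ℝ} (hη : 0 < η) (hv : 0 < v)
    (hκ : κ * x * η ^ 2 ≤ 2 * Real.pi ^ 2 * v) (hx : Real.exp (-κ * x) ≤ 1 / 2) :
    IsFlat η (4 * Real.exp (-κ * x)) v := by
  intro w
  refine (gaussDensity_periodize hv hη w).trans ?_
  have h1 : Real.exp (-(2 * Real.pi ^ 2 * v / η ^ 2)) ≤ Real.exp (-κ * x) := by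
    refine Real.exp_le_exp.2 ?_
    rw [neg_mul, neg_le_neg_iff, le_div_iff₀ (by positivity)]
    exact hκ
  rw [div_le_iff₀ (by linarith)]
  have := Real.exp_pos (-(2 * Real.pi ^ 2 * v / η ^ 2))
  nlinarith [Real.exp_pos (-κ * x)]

/-- Uses (1 + d) / (1 - d) ≤ exp (4 d) for d ≤ 1 / 2, and exp u ≤ 1 + 2 u on [0, 1]. -/
theorem ratio_pow_le {d : ℝ} (hd : 0 ≤ d) (n : ℕ) (h : 12 * n * d ≤ 1) (hd2 : d ≤ 1 / 2) :
    (((1 + d) / (1 - d)) ^ n) ^ 3 - 1 ≤ 24 * n * d ∧ ((1 + d) / (1 - d)) ^ n ≤ 3 := by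
  have h0 : 1 ≤ (1 + d) / (1 - d) := by
    rw [le_div_iff₀ (by linarith)]
    linarith
  have h1 : (1 + d) / (1 - d) ≤ Real.exp (4 * d) := by
    refine le_trans ?_ (Real.add_one_le_exp _)
    rw [div_le_iff₀ (by linarith)]
    nlinarith
  have h2 : (((1 + d) / (1 - d)) ^ n) ^ 3 ≤ Real.exp (12 * n * d) := by
    rw [← pow_mul]
    refine (pow_le_pow_left₀ (by linarith) h1 _).trans_eq ?_
    rw [← Real.exp_nat_mul]
    congr 1
    push_cast
    ring
  have h3 : Real.exp (12 * n * d) ≤ 1 + 2 * (12 * n * d) := by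
    have h4 : 0 ≤ 12 * n * d := by positivity
    have := (abs_le.1 (Real.abs_exp_sub_one_le (x := 12 * n * d) (by rwa [abs_of_nonneg h4]))).2
    rw [abs_of_nonneg h4] at this
    linarith
  refine ⟨by linarith, ?_⟩
  have h5 := le_self_pow₀ (one_le_pow₀ h0 (n := n)) three_ne_zero
  linarith

/-- The far set is cut at (N - 3) σ; one of the three units gained pays for its contribution N² p ≤
σ, which leaves N - 2. -/
theorem eventually_secondMoment_quantLattice_le {β vs Δ : ℝ} (hβ : 0 < β) (hΔ : 0 < Δ)
    (hΔs : Δ < vs) {η : ℕ → ℝ} {r : ℕ → ℕ} (hη : ∀ m, 0 < η m)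
    (hΘ : (fun m => 1 / η m ^ 2) =Θ[atTop] (fun m => (2 : ℝ) ^ m))
    (hr : ∀ m, η m * 2 ^ r m = √((2 : ℝ) ^ m)) :
    ∀ᶠ m in atTop, secondMoment (quantLattice m (r m) (η m) vs Δ β) ≤
      ((2 : ℝ) ^ m - 2) / 2 ^ m * ((vs - Δ) * Δ / vs) := by
  obtain ⟨vr, hvr, rfl⟩ : ∃ vr, 0 < vr ∧ vs = vr + Δ := ⟨vs - Δ, by linarith, by ring⟩
  obtain ⟨σ, hσ⟩ : ∃ σ, σ = vr * Δ / (vr + Δ) := ⟨_, rfl⟩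
  obtain ⟨v₂, hv₂⟩ : ∃ v₂, v₂ = (vr / (vr + Δ)) ^ 2 * (vr + Δ) := ⟨_, rfl⟩
  have hσ0 : 0 < σ := hσ ▸ by positivity
  have hv0 : 0 < v₂ := hv₂ ▸ by positivity
  obtain ⟨A, hA0, hA⟩ := hΘ.1.exists_pos
  obtain ⟨A', hA'0, hA'⟩ := hΘ.2.exists_pos
  obtain ⟨v, hv, hvvr, hvσ, hvv⟩ : ∃ v, 0 < v ∧ v ≤ vr ∧ v ≤ σ ∧ v ≤ v₂ :=
    ⟨min vr (min σ v₂), by positivity, min_le_left _ _, (min_le_right _ _).trans (min_le_left _ _),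
      (min_le_right _ _).trans (min_le_right _ _)⟩
  -- With N ≤ A' / η², this κ keeps the Poisson exponent 2 π² v / η² at least κ N.
  obtain ⟨κ, hκ0, hκ⟩ : ∃ κ, 0 < κ ∧ κ * A' = 2 * Real.pi ^ 2 * v :=
    ⟨2 * Real.pi ^ 2 * v / A', by positivity, by field_simp⟩
  have hpow : Tendsto (fun m : ℕ => (2 : ℝ) ^ m) atTop atTop :=
    tendsto_pow_atTop_atTop_of_one_lt one_lt_two
  have hNnat : Tendsto (fun m : ℕ => 2 ^ m) atTop atTop :=
    tendsto_pow_atTop_atTop_of_one_lt one_lt_two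
  -- This is N² times the eventual bound for p, with d = 4 exp (-κ N) and t = 2 ^ (-N ^ β / 2).
  have hlim : Tendsto (fun x : ℝ => 120 * (96 * (x ^ 3 * Real.exp (-κ * x)) +
      9 / 2 * √A * (x ^ 4 * (2 : ℝ) ^ (-x ^ β / 2)))) atTop (nhds 0) := by
    have := (((tendsto_pow_mul_exp_neg_mul 3 hκ0).const_mul 96).add
      ((tendsto_pow_mul_two_rpow 4 hβ).const_mul (9 / 2 * √A))).const_mul 120
    simpa using this
  -- Ensures 12 N d ≤ 1, as `ratio_pow_le` requires.
  have hexp : Tendsto (fun x : ℝ => 48 * (x ^ 1 * Real.exp (-κ * x))) atTop (nhds 0) := by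
    simpa using (tendsto_pow_mul_exp_neg_mul 1 hκ0).const_mul 48
  filter_upwards [hA.bound, hA'.bound, hpow.eventually (hlim.eventually (gt_mem_nhds hσ0)),
    hpow.eventually (hexp.eventually (gt_mem_nhds one_pos)), hNnat.eventually eventually_prob_le,
    hpow.eventually (eventually_ge_atTop 3)] with m hm1 hm2 hm3 hm4 hprob hm5
  obtain ⟨x, hx⟩ : ∃ x : ℝ, x = 2 ^ m := ⟨_, rfl⟩
  have hxc : ((2 ^ m : ℕ) : ℝ) = x := by rw [hx]; push_cast; rfl
  rw [← hx] at hm1 hm2 hm3 hm4 hm5 ⊢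
  have hηm := hη m
  have hx0 : 0 < x := by linarith
  have hη2 : κ * x * η m ^ 2 ≤ 2 * Real.pi ^ 2 * v := by
    rw [Real.norm_of_nonneg hx0.le, Real.norm_of_nonneg (by positivity), mul_one_div,
      le_div_iff₀ (by positivity)] at hm2
    rw [← hκ, mul_assoc]
    exact mul_le_mul_of_nonneg_left hm2 hκ0.le
  have hE := Real.exp_pos (-κ * x)
  have hE12 : Real.exp (-κ * x) ≤ 1 / 8 := by
    rw [pow_one] at hm4
    nlinarith
  obtain ⟨d, hd⟩ : ∃ d, d = 4 * Real.exp (-κ * x) := ⟨_, rfl⟩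
  have hflat : ∀ v', v ≤ v' → IsFlat (η m) d v' := fun v' hv' =>
    hd ▸ isFlat_of_le hηm (hv.trans_le hv') (hη2.trans (by gcongr)) (by linarith)
  obtain ⟨hK3, hK1⟩ := ratio_pow_le (d := d) (by rw [hd]; positivity) (2 ^ m)
    (by rw [hxc, hd]; linarith) (by linarith)
  obtain ⟨t, ht⟩ : ∃ t : ℝ, t = 2 ^ (-x ^ β / 2) := ⟨_, rfl⟩
  have ht0 : 0 < t := ht ▸ Real.rpow_pos_of_pos two_pos _
  have ht2 : t ^ 2 = 2 ^ (-x ^ β) := by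
    rw [ht, ← Real.rpow_mul_natCast two_pos.le]
    congr 1
    push_cast
    ring
  obtain ⟨e, her, heI, hIe⟩ := exists_firstLevel (r m) (infoSet m (η m) (vr + Δ - Δ) Δ β)
  have hlat : quantLattice m (r m) (η m) (vr + Δ) Δ β =
      (coordLattice m e).map (scaledEmb (2 ^ m) (η m)) :=
    scaledLattice_eq_map m (r m) (η m) _ e her heI hIe
  obtain ⟨Λ, hΛd⟩ : ∃ Λ, Λ = (coordLattice m e).map (scaledEmb (2 ^ m) (η m)) := ⟨_, rfl⟩
  have hZ : ∀ i, ∀ ℓ < e i, 1 - t ^ 2 ≤ bhattacharyya (bitDensity m (η m) vr Δ ℓ i) := by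
    intro i ℓ hℓ
    have := heI i ℓ hℓ
    rw [infoSet, Set.mem_ofPred_eq, not_lt, add_sub_cancel_right, ← hx, ← ht2] at this
    exact this
  have hΛ : Λ ≤ (scaledEmb (2 ^ m) (η m)).range := by
    rw [hΛd]
    rintro _ ⟨z, _, rfl⟩
    exact ⟨z, rfl⟩
  have hΛt : ∀ z : Fin (2 ^ m) → ℤ, scaledEmb (2 ^ m) √x z ∈ Λ := by
    intro z
    rw [hΛd]
    refine ⟨_, pow_mul_mem_coordLattice her z, ?_⟩
    ext i
    rw [scaledEmb_apply, scaledEmb_apply, hx, ← hr m]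
    push_cast
    ring
  have hV := volume_voronoiCell_ne_top (Real.sqrt_pos.2 hx0) hΛt
  have hM : ∀ u ∈ voronoiCell Λ, ‖u‖ ^ 2 ≤ x ^ 2 := by
    intro u hu
    have := norm_sq_le_of_mem_voronoiCell (Real.sqrt_pos.2 hx0) hΛt hu
    rwa [Real.sq_sqrt hx0.le, hxc, ← sq] at this
  have hR0 : 0 ≤ (x - 3) * σ := mul_nonneg (by linarith) hσ0.le
  have hF := isAddFundamentalDomain_voronoiCell hηm hΛ
  have hsm := secondMoment_le hηm (by positivity) hΛ hV hR0 hM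
  obtain ⟨B, hBd⟩ : ∃ B, B = {u | ∀ v ∈ Λ, (x - 3) * σ ≤ ‖u - v‖ ^ 2} := ⟨_, rfl⟩
  have hB : MeasurableSet B := by
    rw [hBd]
    simp only [Set.ofPred_forall]
    exact (isClosed_biInter fun v _ => isClosed_le (by fun_prop) (by fun_prop)).measurableSet
  have hBper : ∀ z ∈ coordLattice m e, ∀ y, y + scaledEmb _ (η m) z ∈ B ↔ y ∈ B := by
    intro z hz y
    have hz' : scaledEmb _ (η m) z ∈ Λ := hΛd ▸ ⟨z, hz, rfl⟩
    rw [hBd]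
    constructor
    · intro h v hv
      have := h _ (add_mem hv hz')
      rwa [add_sub_add_right_eq_sub] at this
    · intro h v hv
      have := h _ (sub_mem hv hz')
      rwa [sub_sub_eq_add_sub] at this
  have hBn : ∀ y ∈ B, (((2 ^ m : ℕ) : ℝ) - 3) * σ ≤ ‖y‖ ^ 2 := by
    intro y hy
    rw [hBd] at hy
    simpa [hxc] using hy 0 (zero_mem Λ)
  rw [← hBd] at hsm
  have hp := hprob σ B (volume.real (B ∩ voronoiCell Λ) / volume.real (voronoiCell Λ)) _ hσ0 hB hBn
    (by positivity) fun s hs => abs_integral_gauss_lattice_sub_le hηm hvr hΔ (by linarith)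
      (hflat _ hvvr) (hflat _ (hv₂ ▸ hvv)) (hflat _ (hσ ▸ hvσ)) ht0 her hV (hΛd ▸ hF) hZ (hσ ▸ hs) hB
      hBper
  -- The crude r ≤ 2 ^ r = √N / η suffices: the number r N of frozen bits stays polynomial in N
  -- while t decays faster than any power.
  have hrx : (r m : ℝ) ≤ √A * x := by
    have h1 : (r m : ℝ) ≤ 2 ^ r m := by exact_mod_cast (Nat.lt_two_pow_self).le
    have h2 : 1 / η m ≤ √A * √x := by
      rw [← Real.sqrt_mul hA0.le]
      refine Real.le_sqrt_of_sq_le ?_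
      rw [Real.norm_of_nonneg hx0.le, Real.norm_of_nonneg (by positivity)] at hm1
      rwa [div_pow, one_pow]
    have h3 : (2 : ℝ) ^ r m = √x * (1 / η m) := by
      rw [hx, ← hr m]
      field_simp
    calc (r m : ℝ) ≤ √x * (1 / η m) := h1.trans_eq h3
      _ ≤ √x * (√A * √x) := by gcongr
      _ = √A * (√x * √x) := by ring
      _ = √A * x := by rw [Real.mul_self_sqrt hx0.le]
  obtain ⟨p, hpd⟩ : ∃ p, p = volume.real (B ∩ voronoiCell Λ) / volume.real (voronoiCell Λ) :=
    ⟨_, rfl⟩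
  rw [← hpd] at hp hsm
  have hp2 : p ≤ 120 * (24 * x * d + 3 * (√A * x * x * (3 / 2 * t))) := by
    refine hp.trans (mul_le_mul_of_nonneg_left (add_le_add ?_ ?_) (by norm_num))
    · rwa [hxc] at hK3
    · push_cast
      rw [← hx]
      gcongr
  have hfin : x ^ 2 * p ≤ σ := by
    refine (mul_le_mul_of_nonneg_left hp2 (sq_nonneg x)).trans (le_trans (le_of_eq ?_) hm3.le)
    rw [← ht, hd]
    ring
  rw [hlat, ← hΛd, add_sub_cancel_right, ← hσ]
  refine hsm.trans ?_
  rw [hxc, div_mul_eq_mul_div]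
  exact div_le_div_of_nonneg_right (by linarith) hx0.le

end PolarLattice

end

theorem mainTheorem5 (β β' : ℝ) (hβ'_pos : 0 < β') (hβ' : β' < β) (hβ : β < 1 / 2) :
    ∃ β'' : ℝ, 0 < β'' ∧ β'' < β' ∧
      ∀ (σs Δ : ℝ), 0 < σs → 0 < Δ → Δ < σs ^ 2 →
      ∀ (η : ℕ → ℝ) (r : ℕ → ℕ), (∀ m, 0 < η m) →
        (fun m => 1 / η m ^ 2) =Θ[atTop] (fun m => (2 : ℝ) ^ m) →
        (∀ m, η m * 2 ^ r m = √((2 : ℝ) ^ m)) →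
        ∀ᶠ m in atTop,
          PolarLattice.secondMoment (PolarLattice.quantLattice m (r m) (η m) (σs ^ 2) Δ β) ≤
            (2 : ℝ) ^ m / ((2 : ℝ) ^ m + 2) *
              ((σs ^ 2 - Δ) * Δ / σs ^ 2 + (2 : ℝ) ^ (-((2 : ℝ) ^ m) ^ β'')) := by
  -- Any exponent in (0, β') would do: the additive term is only discarded, and (N - 2) (N + 2) ≤ N²
  -- compares the prefactors.
  refine ⟨β' / 2, by positivity, by linarith, fun σs Δ hσs hΔ hΔs η r hη hΘ hr => ?_⟩
  filter_upwards [PolarLattice.eventually_secondMoment_quantLattice_le (hβ'_pos.trans hβ') hΔ hΔs hη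
    hΘ hr] with m hm
  refine hm.trans ?_
  have hx : (0 : ℝ) < 2 ^ m := by positivity
  have hσ : 0 ≤ (σs ^ 2 - Δ) * Δ / σs ^ 2 :=
    div_nonneg (mul_nonneg (by linarith) hΔ.le) (sq_nonneg _)
  have hpos : (0 : ℝ) ≤ 2 ^ (-((2 : ℝ) ^ m) ^ (β' / 2)) := Real.rpow_nonneg two_pos.le _
  refine mul_le_mul ?_ (by linarith) hσ (by positivity)
  rw [div_le_div_iff₀ hx (by linarith)]
  nlinarith
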